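/- Let $d\ge 1$ be an integer and let $c\in C([0,1])$. For an interval $(a,b)\subseteq(0,1)$, a continuous function $v$ on $(a,b)$ and a Dirichlet or Neumann condition prescribed at each endpoint, the principal eigenvalue of $$-\varphi''-\tfrac{d-1}{r}\varphi'-v\varphi'+c\varphi=\lambda\varphi\quad\text{on }(a,b)$$ is the real number $\lambda$ for which this problem has a solution $\varphi\in C^1([a,b])\cap C^2((a,b))$ with $\varphi>0$ on $(a,b)$ that satisfies the boundary conditions. Let $\lambda^{\mathcal{DD}}$ and $\lambda^{\mathcal{NN}}$ be the principal eigenvalues with $v=0$ on $(\tfrac13,\tfrac23)$ under Dirichlet conditions $\varphi(\tfrac13)=\varphi(\tfrac23)=0$ and under Neumann conditions $\varphi'(\tfrac13)=\varphi'(\tfrac23)=0$, respectively. For $m\in C^1([0,1])$ and $s\in\mathbb{R}$ let $\lambda(s,m)$ be the principal eigenvalue with $v=2sm'$ on $(0,1)$ under the conditions $\varphi'(0)=\varphi'(1)=0$; this is the radial Neumann problem for $-\Delta\varphi-2s\nabla m\cdot\nabla\varphi+c\varphi=\lambda\varphi$ on the unit ball of $\mathbb{R}^d$. Assume $$\text{(H1)}\qquad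 c(r)>\lambda^{\mathcal{DD}}\quad\text{for all } r\in[0,\tfrac13]\cup[\tfrac23,1].$$ Then $\lambda^{\mathcal{NN}}$ exists and is unique, and there is a function $m\in C^1([0,1])$ with $m=0$ on $[\tfrac13,\tfrac23]$ and $m(r)=m(1-r)$ for all $r\in[0,1]$, which is infinitely oscillating in the sense that it takes both positive and negative values in every left neighbourhood of $\tfrac13$ and in every right neighbourhood of $\tfrac23$, such that $\lambda(s,m)$ exists and is unique for every $s\in\mathbb{R}$ and does not converge to a real number as $s\to+\infty$. Moreover there are sequences $s_n\to+\infty$ and $s_n'\to+\infty$ with $$\lim_{n\to\infty}\lambda(s_n,m)=\lambda^{\mathcal{DD}},\qquad \lim_{n\to\infty}\lambda(s_n',m)=\lambda^{\mathcal{NN}}.$$ -/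

import Mathlib

open Set Filter Topology

/-- The two types of boundary condition. -/
inductive BoundaryType
  | dirichlet
  | neumann

/-- The boundary condition of the given type for a function `φ` on `[a, b]` at an endpoint `e`
(a one-sided derivative in the Neumann case). -/
def BoundaryType.Holds (B : BoundaryType) (a b : ℝ) (φ : ℝ → ℝ) (e : ℝ) : Prop :=
  match B with
  | .dirichlet => φ e = 0
  | .neumann => derivWithin φ (Icc a b) e = 0

/-- `φ` is a positive (classical) eigenfunction for the eigenvalue `μ` of
`-φ'' - ((d - 1) / r) φ' - v φ' + c φ = μ φ` on `(a, b)`,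
with boundary condition `A` at `a` and `B` at `b`. -/
structure IsPositiveEigenfunction (d : ℕ) (v c : ℝ → ℝ) (a b : ℝ) (A B : BoundaryType)
    (μ : ℝ) (φ : ℝ → ℝ) : Prop where
  contDiffOn_closed : ContDiffOn ℝ 1 φ (Icc a b)
  contDiffOn_open : ContDiffOn ℝ 2 φ (Ioo a b)
  equation : ∀ r ∈ Ioo a b,
    -deriv (deriv φ) r - (((d : ℝ) - 1) / r) * deriv φ r - v r * deriv φ r + c r * φ r = μ * φ r
  left : A.Holds a b φ a
  right : B.Holds a b φ b
  pos : ∀ r ∈ Ioo a b, 0 < φ r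

/-- `μ` is the principal eigenvalue, that is, the eigenvalue with a positive eigenfunction. -/
def IsPrincipalEigenvalue (d : ℕ) (v c : ℝ → ℝ) (a b : ℝ) (A B : BoundaryType) (μ : ℝ) : Prop :=
  ∃ φ : ℝ → ℝ, IsPositiveEigenfunction d v c a b A B μ φ

/-- `μ` is the eigenvalue `λ^{AB}`: principal eigenvalue without advection on `(1/3, 2/3)`. -/
def IsMiddleEigenvalue (d : ℕ) (c : ℝ → ℝ) (A B : BoundaryType) (μ : ℝ) : Prop :=
  IsPrincipalEigenvalue d (fun _ => 0) c (1 / 3) (2 / 3) A B μ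

/-- `μ` is the eigenvalue `λ(s, m)`: principal eigenvalue of the radial Neumann problem on the
unit ball of dimension `d` with advection `2 s ∇m`. -/
def IsBallEigenvalue (d : ℕ) (c m : ℝ → ℝ) (s μ : ℝ) : Prop :=
  IsPrincipalEigenvalue d (fun r => 2 * s * deriv m r) c 0 1 .neumann .neumann μ

/-- `m` changes sign infinitely often along the filter `l` (used for one-sided neighbourhoods of
a point): it takes positive and negative values arbitrarily far along `l`. -/
def OscillatesInfinitely (m : ℝ → ℝ) (l : Filter ℝ) : Prop :=
  (∃ᶠ r in l, 0 < m r) ∧ (∃ᶠ r in l, m r < 0)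

/-! With the weight `p = r ^ (d - 1) * exp (2 s m)` the equation becomes `(p φ')' = p (c - λ) φ`. On
the middle third `m = 0`, so the outer thirds influence the middle only through the logarithmic
derivatives of `φ` at `1/3` and `2/3`. A Wronskian with the Dirichlet eigenfunction gives `λ(s, m) <
λ^{DD}` (`lt_dirichlet`). Hence (H1) makes `c - λ` positive on the outer thirds, and `φ`, which
starts with zero flux at `0` and at `1`, increases towards the middle.

How steeply it arrives there depends on the weight just outside the middle. The drift at distance
`t` is `t ^ 2` times the sine of the slow phase `log (1 + log t ^ 2)`. By `exists_osc_peak` there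
are arbitrarily small scales `x` at which `m ≥ x ^ 2 / 8` for `t` in `[x / 2, x]` while `m ≥ -x ^ 4`
on all of `(0, x]`, and other scales with all signs reversed. Put `s = 1 / x ^ 4`. At a positive
peak the weight is of order at least `1 / x ^ 2` on the far half and bounded below up to the
interface, which forces `φ / |φ'| = O(x)` there: nearly a Dirichlet condition. At a negative peak
the weight is `O(x ^ 2)` on the far half and bounded above afterwards, which forces `|φ'| / φ =
O(x)`: nearly a Neumann condition.

Wronskian comparisons with perturbed eigenfunctions (`exists_lower_bound`, `exists_upper_bound`)
turn this into `λ ≥ λ^{DD} - ε` and `λ ≤ λ^{NN} + ε` respectively. The opposite bounds `λ < λ^{DD}`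
and `λ ≥ λ^{NN}` hold without error. Since `λ^{NN} < λ^{DD}`, no limit exists.

Neumann eigenvalues are unique by a Wronskian argument and exist by shooting in the spectral
parameter (`exists_neumann_solution`), where the initial value problem, possibly singular at the
left endpoint, is solved as a Volterra equation. -/

/-- `φ` is a solution of the divergence-form equation `(p φ')' = p g` on `[a, b]`, where `φ₁` is
the derivative of `φ`, continuous up to the boundary. -/
structure IsFluxSolution (p g : ℝ → ℝ) (a b : ℝ) (φ φ₁ : ℝ → ℝ) : Prop where
  continuousOn : ContinuousOn φ (Icc a b)
  continuousOn_deriv : ContinuousOn φ₁ (Icc a b)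
  hasDerivAt : ∀ r ∈ Ioo a b, HasDerivAt φ (φ₁ r) r
  hasDerivAt_flux : ∀ r ∈ Ioo a b, HasDerivAt (fun t => p t * φ₁ t) (p r * g r) r

/-! ### Wronskian monotonicity and the Hopf boundary lemma -/

namespace IsFluxSolution

variable {p g h φ φ₁ u u₁ : ℝ → ℝ} {a b a' b' : ℝ}

theorem mono (H : IsFluxSolution p g a b φ φ₁) (ha : a ≤ a') (hb : b' ≤ b) :
    IsFluxSolution p g a' b' φ φ₁ where
  continuousOn := H.continuousOn.mono (Icc_subset_Icc ha hb)
  continuousOn_deriv := H.continuousOn_deriv.mono (Icc_subset_Icc ha hb)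
  hasDerivAt r hr := H.hasDerivAt r (Ioo_subset_Ioo ha hb hr)
  hasDerivAt_flux r hr := H.hasDerivAt_flux r (Ioo_subset_Ioo ha hb hr)

theorem congr (H : IsFluxSolution p g a b φ φ₁) (hpq : ∀ r ∈ Ioo a b, u r = p r)
    (hgh : ∀ r ∈ Ioo a b, h r = g r) : IsFluxSolution u h a b φ φ₁ where
  continuousOn := H.continuousOn
  continuousOn_deriv := H.continuousOn_deriv
  hasDerivAt := H.hasDerivAt
  hasDerivAt_flux r hr := by
    rw [hpq r hr, hgh r hr]
    refine (H.hasDerivAt_flux r hr).congr_of_eventuallyEq ?_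
    filter_upwards [Ioo_mem_nhds hr.1 hr.2] with t ht
    rw [hpq t ht]

/-- Reflection about the point `1 / 2`. -/
theorem reflect (H : IsFluxSolution p g a b φ φ₁) :
    IsFluxSolution (fun r => p (1 - r)) (fun r => g (1 - r)) (1 - b) (1 - a)
      (fun r => φ (1 - r)) (fun r => -φ₁ (1 - r)) where
  continuousOn := H.continuousOn.comp (by fun_prop) fun r hr => by
    constructor <;> linarith [hr.1, hr.2]
  continuousOn_deriv := (H.continuousOn_deriv.comp (f := fun r : ℝ => 1 - r) (by fun_prop)
    fun r hr => by constructor <;> linarith [hr.1, hr.2]).neg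
  hasDerivAt r hr := by
    have h1 := H.hasDerivAt (1 - r) ⟨by linarith [hr.2], by linarith [hr.1]⟩
    have := h1.comp r ((hasDerivAt_id r).const_sub 1)
    simpa [Function.comp_def] using this
  hasDerivAt_flux r hr := by
    have h1 := H.hasDerivAt_flux (1 - r) ⟨by linarith [hr.2], by linarith [hr.1]⟩
    have := (h1.comp r ((hasDerivAt_id r).const_sub 1)).fun_neg
    simpa [Function.comp_def] using this

/-- The mean value theorem for the solution. -/
theorem exists_sub_eq (H : IsFluxSolution p g a b φ φ₁) {x y : ℝ} (hax : a ≤ x) (hxy : x < y)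
    (hyb : y ≤ b) : ∃ ξ ∈ Ioo x y, φ y - φ x = φ₁ ξ * (y - x) := by
  obtain ⟨ξ, hξ, h⟩ := exists_hasDerivAt_eq_slope φ φ₁ hxy
    (H.mono hax hyb).continuousOn (H.mono hax hyb).hasDerivAt
  refine ⟨ξ, hξ, ?_⟩
  rw [h, div_mul_cancel₀]
  linarith

/-- The mean value theorem for the flux. -/
theorem exists_flux_sub_eq (H : IsFluxSolution p g a b φ φ₁) (hp : ContinuousOn p (Icc a b))
    {x y : ℝ} (hax : a ≤ x) (hxy : x < y) (hyb : y ≤ b) :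
    ∃ ξ ∈ Ioo x y, p y * φ₁ y - p x * φ₁ x = p ξ * g ξ * (y - x) := by
  obtain ⟨ξ, hξ, h⟩ := exists_hasDerivAt_eq_slope (fun t => p t * φ₁ t) _ hxy
    ((hp.mono (Icc_subset_Icc hax hyb)).mul (H.mono hax hyb).continuousOn_deriv)
    (H.mono hax hyb).hasDerivAt_flux
  refine ⟨ξ, hξ, ?_⟩
  rw [h, div_mul_cancel₀]
  linarith

/-- The Wronskian of two solutions strictly increases as soon as its derivative is positive. -/
theorem wronskian_lt (H : IsFluxSolution p g a b φ φ₁) (Hu : IsFluxSolution p h a b u u₁)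
    (hp : ContinuousOn p (Icc a b)) (hab : a < b)
    (hpos : ∀ r ∈ Ioo a b, 0 < p r * (g r * u r - φ r * h r)) :
    p a * (φ₁ a * u a - φ a * u₁ a) < p b * (φ₁ b * u b - φ b * u₁ b) := by
  set W : ℝ → ℝ := fun r => (p r * φ₁ r) * u r - φ r * (p r * u₁ r) with hW
  have hcont : ContinuousOn W (Icc a b) :=
    ((hp.mul H.continuousOn_deriv).mul Hu.continuousOn).sub
      (H.continuousOn.mul (hp.mul Hu.continuousOn_deriv))
  have hd : ∀ r ∈ Ioo a b, HasDerivAt W (p r * (g r * u r - φ r * h r)) r := fun r hr => by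
    have := ((H.hasDerivAt_flux r hr).mul (Hu.hasDerivAt r hr)).sub
      ((H.hasDerivAt r hr).mul (Hu.hasDerivAt_flux r hr))
    exact this.congr_deriv (by ring)
  have hmono : StrictMonoOn W (Icc a b) := by
    refine strictMonoOn_of_deriv_pos (convex_Icc a b) hcont fun r hr => ?_
    rw [interior_Icc] at hr
    rw [(hd r hr).deriv]
    exact hpos r hr
  have := hmono (left_mem_Icc.2 hab.le) (right_mem_Icc.2 hab.le) hab
  simp only [hW] at this
  linarith

/-- A solution that is positive in the interior and vanishes at the right endpoint has a negative
derivative there. -/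
theorem deriv_right_neg {k : ℝ → ℝ} {K : ℝ} (H : IsFluxSolution p (fun r => k r * φ r) a b φ φ₁)
    (hp : ContinuousOn p (Icc a b)) (hab : a < b) (hppos : ∀ r ∈ Icc a b, 0 < p r)
    (hk : ∀ r ∈ Icc a b, |k r| ≤ K) (hpos : ∀ r ∈ Ioo a b, 0 < φ r) (hb : φ b = 0) :
    φ₁ b < 0 := by
  by_contra! hcon
  obtain ⟨x₀, hx₀, hmin⟩ := isCompact_Icc.exists_isMinOn (nonempty_Icc.2 hab.le) hp
  obtain ⟨x₁, hx₁, hmax⟩ := isCompact_Icc.exists_isMaxOn (nonempty_Icc.2 hab.le) hp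
  set p₀ := p x₀
  set P := p x₁
  have hp₀ : 0 < p₀ := hppos _ hx₀
  have hP : 0 < P := hppos _ hx₁
  have hK : 0 ≤ K := (abs_nonneg _).trans (hk a (left_mem_Icc.2 hab.le))
  -- On `[b - δ, b]` let `N` be the maximum of `φ`. If the flux at `b` were nonnegative, integrating
  -- the equation backwards would give `-φ₁ ≤ P K N δ / p₀` at the mean value point `ζ`, hence `N ≤
  -- P K N δ² / p₀`; this choice of `δ` makes that impossible.
  obtain ⟨δ, hδ, hδab, hδs⟩ : ∃ δ > 0, δ < b - a ∧ δ * δ * (P * K) < p₀ := by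
    have ht : Tendsto (fun δ : ℝ => δ * δ * (P * K)) (𝓝[>] 0) (𝓝 0) := by
      have : Tendsto (fun δ : ℝ => δ * δ * (P * K)) (𝓝 0) (𝓝 (0 * 0 * (P * K))) :=
        Continuous.tendsto (by fun_prop) 0
      simp only [mul_zero, zero_mul] at this
      exact this.mono_left nhdsWithin_le_nhds
    have h2 : ∀ᶠ δ : ℝ in 𝓝[>] 0, δ < b - a :=
      nhdsWithin_le_nhds (Iio_mem_nhds (by linarith))
    obtain ⟨δ, h1, h2, h3⟩ :=
      ((ht.eventually_lt_const hp₀).and (h2.and self_mem_nhdsWithin)).exists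
    exact ⟨δ, h3, h2, h1⟩
  have haδ : a < b - δ := by linarith
  have hδb : b - δ < b := by linarith
  obtain ⟨ξ, hξ, hξmax⟩ := isCompact_Icc.exists_isMaxOn (nonempty_Icc.2 hδb.le)
    (H.mono haδ.le le_rfl).continuousOn
  have hN : 0 < φ ξ := lt_of_lt_of_le (hpos (b - δ) ⟨haδ, hδb⟩)
    (hξmax (left_mem_Icc.2 hδb.le))
  have hξb : ξ < b := lt_of_le_of_ne hξ.2 fun h => by rw [h, hb] at hN; exact lt_irrefl _ hN
  obtain ⟨ζ, hζ, e1⟩ := H.exists_sub_eq (haδ.le.trans hξ.1) hξb le_rfl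
  have haζ : a < ζ := haδ.trans_le (hξ.1.trans hζ.1.le)
  obtain ⟨η, hη, e2⟩ := H.exists_flux_sub_eq hp haζ.le hζ.2 le_rfl
  have hηmem : η ∈ Icc a b := ⟨haζ.le.trans hη.1.le, hη.2.le⟩
  have hζmem : ζ ∈ Icc a b := ⟨haζ.le, hζ.2.le⟩
  have hφη : φ η ≤ φ ξ := hξmax ⟨hξ.1.trans (hζ.1.le.trans hη.1.le), hη.2.le⟩
  have hφη0 : 0 ≤ φ η := (hpos η ⟨haζ.trans hη.1, hη.2⟩).le
  have hpb : 0 ≤ p b * φ₁ b := mul_nonneg (hppos b (right_mem_Icc.2 hab.le)).le hcon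
  have hbound : p η * (k η * φ η) * (b - ζ) ≤ P * (K * φ ξ) * δ := by
    have h1 : k η * φ η ≤ K * φ ξ :=
      (mul_le_mul_of_nonneg_right ((le_abs_self _).trans (hk η hηmem)) hφη0).trans
        (mul_le_mul_of_nonneg_left hφη hK)
    have h2 : p η * (k η * φ η) ≤ P * (K * φ ξ) :=
      (mul_le_mul_of_nonneg_left h1 (hppos η hηmem).le).trans
        (mul_le_mul_of_nonneg_right (hmax hηmem) (by positivity))
    exact mul_le_mul h2 (by linarith [hξ.1, hζ.1]) (by linarith [hζ.2]) (by positivity)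
  have hflux : -(p ζ * φ₁ ζ) ≤ P * (K * φ ξ) * δ := by linarith
  rw [hb] at e1
  have hφ1 : 0 ≤ -φ₁ ζ := by
    by_contra! hc
    nlinarith
  have h3 : p₀ * (-φ₁ ζ) ≤ p ζ * (-φ₁ ζ) := mul_le_mul_of_nonneg_right (hmin hζmem) hφ1
  have h4 : φ ξ ≤ -φ₁ ζ * δ := by
    have : -φ₁ ζ * (b - ξ) ≤ -φ₁ ζ * δ :=
      mul_le_mul_of_nonneg_left (by linarith [hξ.1]) hφ1
    linarith
  have h5 : p₀ * φ ξ ≤ δ * δ * (P * K) * φ ξ := by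
    calc p₀ * φ ξ ≤ p₀ * (-φ₁ ζ * δ) := mul_le_mul_of_nonneg_left h4 hp₀.le
      _ = (p₀ * -φ₁ ζ) * δ := by ring
      _ ≤ (P * (K * φ ξ) * δ) * δ := mul_le_mul_of_nonneg_right (by linarith) hδ.le
      _ = _ := by ring
  exact absurd (le_of_mul_le_mul_right h5 hN) (not_le.2 hδs)

/-- A solution that is positive in the interior and vanishes at the left endpoint has a positive
derivative there. -/
theorem deriv_left_pos {k : ℝ → ℝ} {K : ℝ} (H : IsFluxSolution p (fun r => k r * φ r) a b φ φ₁)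
    (hp : ContinuousOn p (Icc a b)) (hab : a < b) (hppos : ∀ r ∈ Icc a b, 0 < p r)
    (hk : ∀ r ∈ Icc a b, |k r| ≤ K) (hpos : ∀ r ∈ Ioo a b, 0 < φ r) (ha : φ a = 0) :
    0 < φ₁ a := by
  have key : ∀ r ∈ Icc (1 - b) (1 - a), 1 - r ∈ Icc a b := fun r hr =>
    ⟨by linarith [hr.2], by linarith [hr.1]⟩
  have := deriv_right_neg (k := fun r => k (1 - r)) (K := K) H.reflect
    (hp.comp (by fun_prop) key) (by linarith) (fun r hr => hppos _ (key r hr))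
    (fun r hr => hk _ (key r hr))
    (fun r hr => hpos _ ⟨by linarith [hr.2], by linarith [hr.1]⟩) (by simpa using ha)
  simpa using this

end IsFluxSolution

/-! ### The initial value problem with a weight that may vanish at the left endpoint -/

/-- The derivative of the solution of `(p φ')' = p g` whose flux vanishes at `a`. -/
noncomputable def fluxMean (p : ℝ → ℝ) (a : ℝ) (g : ℝ → ℝ) (t : ℝ) : ℝ :=
  (∫ τ in a..t, p τ * g τ) / p t

section FluxMean

variable {p g h G : ℝ → ℝ} {a b M : ℝ}

@[simp]
theorem fluxMean_self : fluxMean p a g a = 0 := by simp [fluxMean]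

theorem fluxMean_congr (hgh : ∀ r ∈ Icc a b, g r = h r) {t : ℝ} (ht : t ∈ Icc a b) :
    fluxMean p a g t = fluxMean p a h t := by
  unfold fluxMean
  congr 1
  refine intervalIntegral.integral_congr fun τ hτ => ?_
  rw [uIcc_of_le ht.1] at hτ
  simp only [hgh τ ⟨hτ.1, hτ.2.trans ht.2⟩]

theorem fluxMean_add (hp : Continuous p) (hg : Continuous g) (hh : Continuous h) (t : ℝ) :
    fluxMean p a (fun r => g r + h r) t = fluxMean p a g t + fluxMean p a h t := by
  unfold fluxMean
  simp only [mul_add]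
  rw [← add_div, ← intervalIntegral.integral_add]
  exacts [(hp.mul hg).intervalIntegrable _ _, (hp.mul hh).intervalIntegrable _ _]

theorem fluxMean_const_mul (x t : ℝ) :
    fluxMean p a (fun r => x * g r) t = x * fluxMean p a g t := by
  unfold fluxMean
  rw [← mul_div_assoc, ← intervalIntegral.integral_const_mul]
  congr 2
  funext r
  ring

/-- The condition `p r ≤ M * p t` for `r ≤ t` replaces a positive lower bound on `p`: the weight
under the integral is dominated by its value in the denominator. This covers `r ^ (d - 1)` at the
centre of the ball, where the quotient is `0 / 0` for `d > 1`. -/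
theorem abs_fluxMean_le (hpos : ∀ r ∈ Ioc a b, 0 < p r)
    (hM : ∀ r ∈ Icc a b, ∀ t ∈ Icc a b, r ≤ t → p r ≤ M * p t)
    (hG : Continuous G) (hgG : ∀ r ∈ Icc a b, |g r| ≤ G r) {t : ℝ} (ht : t ∈ Icc a b) :
    |fluxMean p a g t| ≤ M * ∫ τ in a..t, G τ := by
  rcases eq_or_lt_of_le ht.1 with rfl | hat
  · simp
  have hpt : 0 < p t := hpos t ⟨hat, ht.2⟩
  unfold fluxMean
  rw [abs_div, abs_of_pos hpt, div_le_iff₀ hpt]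
  have h1 : ‖∫ τ in a..t, p τ * g τ‖ ≤ ∫ τ in a..t, M * p t * G τ := by
    refine intervalIntegral.norm_integral_le_of_norm_le hat.le ?_
      ((hG.intervalIntegrable _ _).const_mul _)
    refine .of_forall fun τ hτ => ?_
    have hτ' : τ ∈ Icc a b := ⟨hτ.1.le, hτ.2.trans ht.2⟩
    have hpτ : 0 < p τ := hpos τ ⟨hτ.1, hτ'.2⟩
    rw [norm_mul, Real.norm_eq_abs, Real.norm_eq_abs, abs_of_pos hpτ]
    exact mul_le_mul (hM τ hτ' t ht hτ.2) (hgG τ hτ') (abs_nonneg _)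
      (hpτ.le.trans (hM τ hτ' t ht hτ.2))
  rw [intervalIntegral.integral_const_mul, Real.norm_eq_abs] at h1
  linarith

theorem continuousOn_fluxMean (hp : Continuous p) (hpos : ∀ r ∈ Ioc a b, 0 < p r)
    (hM : ∀ r ∈ Icc a b, ∀ t ∈ Icc a b, r ≤ t → p r ≤ M * p t) (hg : Continuous g) :
    ContinuousOn (fluxMean p a g) (Icc a b) := by
  intro t ht
  have hI : Continuous fun t => ∫ τ in a..t, p τ * g τ :=
    intervalIntegral.continuous_primitive (fun x y => (hp.mul hg).intervalIntegrable x y) a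
  rcases eq_or_lt_of_le ht.1 with rfl | hat
  · have hb := squeeze_zero_norm' (f := fluxMean p a g) (t₀ := 𝓝[Icc a b] a)
      (a := fun t => M * ∫ τ in a..t, |g τ|)
      (by
        filter_upwards [self_mem_nhdsWithin] with t ht
        exact abs_fluxMean_le hpos hM hg.abs (fun _ _ => le_rfl) ht)
      (by
        have hc : Continuous fun t => M * ∫ τ in a..t, |g τ| :=
          continuous_const.mul (intervalIntegral.continuous_primitive
            (fun x y => hg.abs.intervalIntegrable x y) a)
        have := hc.tendsto a
        simp only [intervalIntegral.integral_same, mul_zero] at this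
        exact this.mono_left nhdsWithin_le_nhds)
    simpa [ContinuousWithinAt] using hb
  · exact (hI.continuousAt.div hp.continuousAt (hpos t ⟨hat, ht.2⟩).ne').continuousWithinAt

theorem mul_fluxMean (hpos : ∀ r ∈ Ioc a b, 0 < p r) {t : ℝ} (ht : t ∈ Icc a b) :
    p t * fluxMean p a g t = ∫ τ in a..t, p τ * g τ := by
  rcases eq_or_lt_of_le ht.1 with rfl | hat
  · simp
  · rw [fluxMean, mul_div_cancel₀]
    exact (hpos t ⟨hat, ht.2⟩).ne'

end FluxMean

section Volterra

variable {p : ℝ → ℝ} {a b M κ : ℝ}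

/-- The Volterra operator solving `(p φ')' = p g`, conjugated by an exponential weight. -/
theorem exists_volterra_operator (hab : a ≤ b) (hp : Continuous p)
    (hpos : ∀ r ∈ Ioc a b, 0 < p r) (hM0 : 0 ≤ M)
    (hM : ∀ r ∈ Icc a b, ∀ t ∈ Icc a b, r ≤ t → p r ≤ M * p t) (hκ : 0 < κ) :
    ∃ A : C(Icc a b, ℝ) →L[ℝ] C(Icc a b, ℝ), ‖A‖ ≤ M / κ ^ 2 ∧
      ∀ (f : C(Icc a b, ℝ)) (r : Icc a b), A f r = Real.exp (-(κ * (r - a))) *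
        ∫ t in a..r, fluxMean p a (fun τ => Real.exp (κ * (τ - a)) * IccExtend hab f τ) t := by
  have hcf : ∀ f : C(Icc a b, ℝ),
      Continuous fun τ => Real.exp (κ * (τ - a)) * IccExtend hab f τ := fun f =>
    (by fun_prop : Continuous fun τ => Real.exp (κ * (τ - a))).mul f.continuous.Icc_extend'
  have hcm : ∀ f : C(Icc a b, ℝ), ContinuousOn (fluxMean p a
      fun τ => Real.exp (κ * (τ - a)) * IccExtend hab f τ) (Icc a b) := fun f =>
    continuousOn_fluxMean hp hpos hM (hcf f)
  have hint : ∀ (f : C(Icc a b, ℝ)) (r : Icc a b), IntervalIntegrable (fluxMean p a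
      fun τ => Real.exp (κ * (τ - a)) * IccExtend hab f τ) MeasureTheory.volume a r :=
    fun f r => ((hcm f).mono (by
      rw [uIcc_of_le r.2.1]
      exact Icc_subset_Icc le_rfl r.2.2)).intervalIntegrable
  have hcont : ∀ f : C(Icc a b, ℝ), Continuous fun r : Icc a b => Real.exp (-(κ * (r - a))) *
      ∫ t in a..r, fluxMean p a (fun τ => Real.exp (κ * (τ - a)) * IccExtend hab f τ) t := by
    intro f
    refine (by fun_prop : Continuous fun r : Icc a b => Real.exp (-(κ * (r - a)))).mul ?_
    have h1 := intervalIntegral.continuousOn_primitive_interval (μ := MeasureTheory.volume)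
      (a := a) (b := b) (f := fluxMean p a
        fun τ => Real.exp (κ * (τ - a)) * IccExtend hab f τ)
      (by rw [uIcc_of_le hab]; exact (hcm f).integrableOn_Icc)
    rw [uIcc_of_le hab] at h1
    exact continuousOn_iff_continuous_domRestrict.1 h1
  -- Integrating the exponential weight gains a factor `1 / κ`; the two integrations in the operator
  -- account for `κ ^ 2` in the norm bound.
  have hI : ∀ t, ∫ τ in a..t, Real.exp (κ * (τ - a)) ≤ Real.exp (κ * (t - a)) / κ := by
    intro t
    have hd : ∀ x ∈ uIcc a t, HasDerivAt (fun x => Real.exp (κ * (x - a)) / κ)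
        (Real.exp (κ * (x - a))) x := fun x _ => by
      have := ((((hasDerivAt_id x).sub_const a).const_mul κ).exp).div_const κ
      refine this.congr_deriv ?_
      simp [hκ.ne']
    rw [intervalIntegral.integral_eq_sub_of_hasDerivAt hd
      (Continuous.intervalIntegrable (by fun_prop) _ _)]
    have : 0 ≤ Real.exp (κ * (a - a)) / κ := by positivity
    linarith
  have hbound : ∀ (f : C(Icc a b, ℝ)) (r : Icc a b), ‖Real.exp (-(κ * (r - a))) *
      ∫ t in a..r, fluxMean p a (fun τ => Real.exp (κ * (τ - a)) * IccExtend hab f τ) t‖ ≤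
        M / κ ^ 2 * ‖f‖ := by
    intro f r
    have h1 : ∀ t ∈ Icc a b, |fluxMean p a
        (fun τ => Real.exp (κ * (τ - a)) * IccExtend hab f τ) t| ≤
          M * ‖f‖ / κ * Real.exp (κ * (t - a)) := by
      intro t ht
      refine (abs_fluxMean_le (G := fun τ => ‖f‖ * Real.exp (κ * (τ - a))) hpos hM
        (by fun_prop) (fun x hx => ?_) ht).trans ?_
      · rw [abs_mul, Real.abs_exp, mul_comm]
        refine mul_le_mul_of_nonneg_right ?_ (Real.exp_pos _).le
        rw [IccExtend_of_mem _ _ hx]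
        exact f.norm_coe_le_norm _
      · rw [intervalIntegral.integral_const_mul]
        calc M * (‖f‖ * ∫ τ in a..t, Real.exp (κ * (τ - a)))
            ≤ M * (‖f‖ * (Real.exp (κ * (t - a)) / κ)) := by gcongr; exact hI t
          _ = _ := by ring
    have h2 : ‖∫ t in a..r, fluxMean p a
        (fun τ => Real.exp (κ * (τ - a)) * IccExtend hab f τ) t‖ ≤
          ∫ t in a..r, M * ‖f‖ / κ * Real.exp (κ * (t - a)) := by
      refine intervalIntegral.norm_integral_le_of_norm_le r.2.1 ?_
        (Continuous.intervalIntegrable (by fun_prop) _ _)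
      exact .of_forall fun t ht => h1 t ⟨ht.1.le, ht.2.trans r.2.2⟩
    rw [intervalIntegral.integral_const_mul] at h2
    rw [norm_mul, Real.norm_eq_abs, Real.abs_exp]
    calc Real.exp (-(κ * (r - a))) * ‖∫ t in a..r, fluxMean p a
          (fun τ => Real.exp (κ * (τ - a)) * IccExtend hab f τ) t‖
        ≤ Real.exp (-(κ * (r - a))) * (M * ‖f‖ / κ * (Real.exp (κ * (r - a)) / κ)) := by
          gcongr
          exact h2.trans (by gcongr; exact hI r)
      _ = (Real.exp (-(κ * (r - a))) * Real.exp (κ * (r - a))) * (M / κ ^ 2 * ‖f‖) := by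
          field_simp
      _ = M / κ ^ 2 * ‖f‖ := by rw [← Real.exp_add]; simp
  let A₀ : C(Icc a b, ℝ) →ₗ[ℝ] C(Icc a b, ℝ) :=
    { toFun := fun f => ⟨_, hcont f⟩
      map_add' := fun f g => by
        ext r
        simp only [ContinuousMap.coe_mk, ContinuousMap.add_apply]
        rw [← mul_add, ← intervalIntegral.integral_add (hint f r) (hint g r)]
        congr 2
        funext t
        rw [← fluxMean_add hp (hcf f) (hcf g)]
        congr 1
        funext τ
        simp only [IccExtend, Function.comp, ContinuousMap.add_apply]
        ring
      map_smul' := fun x f => by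
        ext r
        simp only [ContinuousMap.coe_mk, ContinuousMap.smul_apply, RingHom.id_apply, smul_eq_mul]
        rw [mul_left_comm x]
        congr 1
        rw [← intervalIntegral.integral_const_mul]
        congr 1
        funext t
        rw [← fluxMean_const_mul]
        congr 1
        funext τ
        simp only [IccExtend, Function.comp, ContinuousMap.smul_apply, smul_eq_mul]
        ring }
  have hA : ∀ f, ‖A₀ f‖ ≤ M / κ ^ 2 * ‖f‖ := fun f =>
    (ContinuousMap.norm_le _ (by positivity)).2 (hbound f)
  exact ⟨A₀.mkContinuous _ hA, A₀.mkContinuous_norm_le (by positivity) hA, fun f r => rfl⟩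

end Volterra

section Shooting

variable {p c : ℝ → ℝ} {a b M : ℝ}

/-- The solutions of `(p φ')' = p (c - μ) φ` with `φ a = 1` and vanishing flux at `a` exist and
depend continuously on `μ`. -/
theorem exists_shooting_family (hab : a < b) (hp : Continuous p)
    (hpos : ∀ r ∈ Ioc a b, 0 < p r) (hM0 : 0 ≤ M)
    (hM : ∀ r ∈ Icc a b, ∀ t ∈ Icc a b, r ≤ t → p r ≤ M * p t)
    (hc : Continuous c) (L₀ L₁ : ℝ) :
    ∃ Φ Φ₁ : ℝ → ℝ → ℝ,
      (∀ μ ∈ Icc L₀ L₁, Φ μ a = 1 ∧ Φ₁ μ a = 0 ∧ Continuous (Φ₁ μ) ∧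
        (∀ r, HasDerivAt (Φ μ) (Φ₁ μ r) r) ∧
        IsFluxSolution p (fun r => (c r - μ) * Φ μ r) a b (Φ μ) (Φ₁ μ)) ∧
      (∀ μ ∈ Icc L₀ L₁, TendstoUniformlyOn Φ (Φ μ) (𝓝[Icc L₀ L₁] μ) (Icc a b)) ∧
      ContinuousOn (fun μ => Φ₁ μ b) (Icc L₀ L₁) := by
  let cK : C(Icc a b, ℝ) := ⟨fun r => c r, by fun_prop⟩
  set C : ℝ := ‖cK‖ + |L₀| + |L₁| with hC
  have hC0 : 0 ≤ C := by positivity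
  -- `C` bounds `c - μ` uniformly for `μ` in `[L₀, L₁]`, and `M * C < (1 + M * C) ^ 2` makes every
  -- `T μ` a strict contraction. Invertibility of `1 - T μ` then gives both existence and continuity
  -- in `μ`.
  set κ : ℝ := 1 + M * C with hκdef
  have hMC : 0 ≤ M * C := by positivity
  have hκ : 0 < κ := by linarith
  obtain ⟨A, hA, hAf⟩ := exists_volterra_operator hab.le hp hpos hM0 hM hκ
  let T : ℝ → C(Icc a b, ℝ) →L[ℝ] C(Icc a b, ℝ) := fun μ =>
    A.comp (ContinuousLinearMap.mul ℝ C(Icc a b, ℝ) (cK - μ • 1))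
  have hTcont : Continuous T := by fun_prop
  have hT1 : ∀ μ ∈ Icc L₀ L₁, ‖T μ‖ < 1 := by
    intro μ hμ
    have h1 : ‖cK - μ • (1 : C(Icc a b, ℝ))‖ ≤ C := by
      refine (norm_sub_le _ _).trans ?_
      have : ‖μ • (1 : C(Icc a b, ℝ))‖ ≤ |L₀| + |L₁| := by
        rw [norm_smul]
        have h1 : ‖(1 : C(Icc a b, ℝ))‖ ≤ 1 :=
          (ContinuousMap.norm_le _ zero_le_one).2 fun x => by simp
        have h2 : ‖μ‖ ≤ |L₀| + |L₁| := by
          rw [Real.norm_eq_abs, abs_le]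
          constructor
          · linarith [neg_abs_le L₀, abs_nonneg L₁, hμ.1]
          · linarith [le_abs_self L₁, abs_nonneg L₀, hμ.2]
        nlinarith [norm_nonneg μ]
      linarith
    have h2 : ‖ContinuousLinearMap.mul ℝ C(Icc a b, ℝ) (cK - μ • 1)‖ ≤ C :=
      (ContinuousLinearMap.opNorm_mul_apply_le _ _ _).trans h1
    calc ‖T μ‖ ≤ ‖A‖ * ‖ContinuousLinearMap.mul ℝ C(Icc a b, ℝ) (cK - μ • 1)‖ :=
          ContinuousLinearMap.opNorm_comp_le _ _
      _ ≤ M / κ ^ 2 * C := by gcongr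
      _ = M * C / κ ^ 2 := by ring
      _ < 1 := by
        rw [div_lt_one (by positivity), hκdef]
        nlinarith
  have hunit : ∀ μ ∈ Icc L₀ L₁, IsUnit (1 - T μ) := fun μ hμ =>
    isUnit_one_sub_of_norm_lt_one (R := C(Icc a b, ℝ) →L[ℝ] C(Icc a b, ℝ)) (hT1 μ hμ)
  -- The initial value `1` after conjugation by the exponential weight; `Ψ` undoes the conjugation.
  let e : C(Icc a b, ℝ) := ⟨fun r => Real.exp (-(κ * (r - a))), by fun_prop⟩
  let U : ℝ → C(Icc a b, ℝ) := fun μ => Ring.inverse (1 - T μ) e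
  have hUcont : ContinuousOn U (Icc L₀ L₁) := by
    intro μ hμ
    obtain ⟨w, hw⟩ := hunit μ hμ
    have h1 : ContinuousAt (fun μ => Ring.inverse (1 - T μ)) μ := by
      have := NormedRing.inverse_continuousAt (R := C(Icc a b, ℝ) →L[ℝ] C(Icc a b, ℝ)) w
      rw [hw] at this
      exact ContinuousAt.comp (f := fun μ => 1 - T μ) this (by fun_prop)
    exact (h1.clm_apply continuousAt_const).continuousWithinAt
  have hU : ∀ μ ∈ Icc L₀ L₁, U μ = e + A ((cK - μ • 1) * U μ) := by
    intro μ hμ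
    have h1 : (1 - T μ) * Ring.inverse (1 - T μ) = 1 :=
      Ring.mul_inverse_cancel _ (hunit μ hμ)
    have h2 := congrArg (fun B : C(Icc a b, ℝ) →L[ℝ] C(Icc a b, ℝ) => B e) h1
    have h3 : U μ - A ((cK - μ • 1) * U μ) = e := h2
    rw [← h3]
    abel
  let Ψ : ℝ → ℝ → ℝ := fun μ r => Real.exp (κ * (r - a)) * IccExtend hab.le (U μ) r
  have hΨc : ∀ μ, Continuous (Ψ μ) := fun μ =>
    (by fun_prop : Continuous fun r => Real.exp (κ * (r - a))).mul (U μ).continuous.Icc_extend'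
  have hgc : ∀ μ, Continuous fun r => (c r - μ) * Ψ μ r := fun μ =>
    (hc.sub continuous_const).mul (hΨc μ)
  have hmc : ∀ μ, ContinuousOn (fluxMean p a fun r => (c r - μ) * Ψ μ r) (Icc a b) := fun μ =>
    continuousOn_fluxMean hp hpos hM (hgc μ)
  -- The derivative is extended by constants outside `[a, b]`, so that its primitive `Φ` is
  -- differentiable on the whole line, endpoints included.
  let Φ₁ : ℝ → ℝ → ℝ := fun μ =>
    IccExtend hab.le ((Icc a b).domRestrict (fluxMean p a fun r => (c r - μ) * Ψ μ r))
  have hΦ₁ : ∀ μ, ∀ r ∈ Icc a b, Φ₁ μ r = fluxMean p a (fun r => (c r - μ) * Ψ μ r) r :=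
    fun μ r hr => IccExtend_of_mem _ _ hr
  have hΦ₁c : ∀ μ, Continuous (Φ₁ μ) := fun μ =>
    (continuousOn_iff_continuous_domRestrict.1 (hmc μ)).Icc_extend'
  let Φ : ℝ → ℝ → ℝ := fun μ r => 1 + ∫ t in a..r, Φ₁ μ t
  have hΦd : ∀ μ r, HasDerivAt (Φ μ) (Φ₁ μ r) r := fun μ r =>
    (intervalIntegral.integral_hasDerivAt_right ((hΦ₁c μ).intervalIntegrable _ _)
      ((hΦ₁c μ).stronglyMeasurableAtFilter _ _) (hΦ₁c μ).continuousAt).const_add 1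
  have hΦΨ : ∀ μ ∈ Icc L₀ L₁, ∀ r ∈ Icc a b, Φ μ r = Ψ μ r := by
    intro μ hμ r hr
    have h1 := congrArg (fun f : C(Icc a b, ℝ) => f ⟨r, hr⟩) (hU μ hμ)
    simp only [ContinuousMap.add_apply, hAf] at h1
    have h2 : ∫ t in a..r, fluxMean p a (fun τ => Real.exp (κ * (τ - a)) *
        IccExtend hab.le ⇑((cK - μ • 1) * U μ) τ) t = ∫ t in a..r, Φ₁ μ t := by
      refine intervalIntegral.integral_congr fun t ht => ?_
      rw [uIcc_of_le hr.1] at ht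
      have ht' : t ∈ Icc a b := ⟨ht.1, ht.2.trans hr.2⟩
      simp only [hΦ₁ μ t ht']
      refine fluxMean_congr (fun x hx => ?_) ht'
      simp only [Ψ, IccExtend_of_mem _ _ hx, ContinuousMap.mul_apply, ContinuousMap.sub_apply,
        ContinuousMap.smul_apply, ContinuousMap.one_apply, smul_eq_mul, cK, ContinuousMap.coe_mk]
      ring
    have h3 : Real.exp (κ * (r - a)) * Real.exp (-(κ * (r - a))) = 1 := by
      rw [← Real.exp_add]; simp
    rw [h2] at h1
    simp only [Φ, Ψ, IccExtend_of_mem _ _ hr, h1, e, ContinuousMap.coe_mk]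
    rw [← mul_one_add, ← mul_assoc, h3, one_mul]
  refine ⟨Φ, Φ₁, fun μ hμ => ⟨by simp [Φ], by simp [hΦ₁ μ a (left_mem_Icc.2 hab.le)], hΦ₁c μ,
    hΦd μ, ?_⟩, ?_, ?_⟩
  · refine ⟨fun r _ => (hΦd μ r).continuousAt.continuousWithinAt, (hΦ₁c μ).continuousOn,
      fun r _ => hΦd μ r, fun r hr => ?_⟩
    have hr' := Ioo_subset_Icc_self hr
    rw [hΦΨ μ hμ r hr']
    have hcont : Continuous fun r => p r * ((c r - μ) * Ψ μ r) := hp.mul (hgc μ)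
    have h1 : HasDerivAt (fun t => ∫ τ in a..t, p τ * ((c τ - μ) * Ψ μ τ))
        (p r * ((c r - μ) * Ψ μ r)) r :=
      intervalIntegral.integral_hasDerivAt_right (hcont.intervalIntegrable _ _)
        (hcont.stronglyMeasurableAtFilter _ _) hcont.continuousAt
    refine h1.congr_of_eventuallyEq ?_
    filter_upwards [Ioo_mem_nhds hr.1 hr.2] with t ht
    have ht' := Ioo_subset_Icc_self ht
    rw [hΦ₁ μ t ht', mul_fluxMean hpos ht']
  · intro μ hμ
    rw [Metric.tendstoUniformlyOn_iff]
    intro ε hε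
    set E := Real.exp (κ * (b - a)) with hE
    have hE0 : 0 < E := Real.exp_pos _
    have h1 := Metric.tendsto_nhds.1 (hUcont μ hμ) (ε / E) (by positivity)
    filter_upwards [h1, self_mem_nhdsWithin] with ν hν hν' r hr
    rw [hΦΨ μ hμ r hr, hΦΨ ν hν' r hr, dist_comm, Real.dist_eq]
    simp only [Ψ, IccExtend_of_mem _ _ hr]
    rw [← mul_sub, abs_mul, Real.abs_exp]
    have h2 : |U ν ⟨r, hr⟩ - U μ ⟨r, hr⟩| < ε / E := by
      have := ContinuousMap.dist_apply_le_dist (f := U ν) (g := U μ) ⟨r, hr⟩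
      rw [Real.dist_eq] at this
      exact this.trans_lt hν
    calc Real.exp (κ * (r - a)) * |U ν ⟨r, hr⟩ - U μ ⟨r, hr⟩|
        ≤ E * |U ν ⟨r, hr⟩ - U μ ⟨r, hr⟩| := by
          refine mul_le_mul_of_nonneg_right (Real.exp_le_exp.2 ?_) (abs_nonneg _)
          exact mul_le_mul_of_nonneg_left (by linarith [hr.2]) hκ.le
      _ < E * (ε / E) := by gcongr
      _ = ε := by field_simp
  · have hb := right_mem_Icc.2 hab.le
    simp only [hΦ₁ _ b hb, fluxMean]
    refine ContinuousOn.div_const ?_ _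
    have hjoint : ContinuousOn (fun q : ℝ × ℝ => p q.2 * ((c q.2 - q.1) * Ψ q.1 q.2))
        (Icc L₀ L₁ ×ˢ univ) := by
      have : ContinuousOn (fun q : ℝ × ℝ => U q.1 (projIcc a b hab.le q.2))
          (Icc L₀ L₁ ×ˢ univ) := by
        have h1 : ContinuousOn (fun q : ℝ × ℝ => U q.1) (Icc L₀ L₁ ×ˢ univ) :=
          hUcont.comp continuousOn_fst fun q hq => hq.1
        have h2 : ContinuousOn (fun q : ℝ × ℝ => projIcc a b hab.le q.2) (Icc L₀ L₁ ×ˢ univ) :=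
          (continuous_projIcc.comp continuous_snd).continuousOn
        exact ContinuousEval.continuous_eval.comp_continuousOn (h1.prodMk h2)
      simp only [Ψ, IccExtend, Function.comp]
      have h2 : Continuous fun q : ℝ × ℝ => p q.2 * ((c q.2 - q.1) * Real.exp (κ * (q.2 - a))) := by
        fun_prop
      refine (h2.continuousOn.mul this).congr fun q _ => ?_
      simp only [Pi.mul_apply]
      ring
    rw [continuousOn_iff_continuous_domRestrict]
    refine intervalIntegral.continuous_parametric_intervalIntegral_of_continuous'
      (f := fun (μ : Icc L₀ L₁) τ => p τ * ((c τ - μ) * Ψ μ τ)) ?_ a b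
    exact hjoint.comp_continuous (f := fun q : Icc L₀ L₁ × ℝ => ((q.1 : ℝ), q.2))
      (by fun_prop) fun q => ⟨q.1.2, mem_univ _⟩

end Shooting

/-! ### Existence of the principal Neumann eigenvalue by shooting -/

theorem exists_first_zero {f : ℝ → ℝ} {a b x : ℝ} (hf : ContinuousOn f (Icc a b)) (ha : 0 < f a)
    (hx : x ∈ Icc a b) (hfx : f x ≤ 0) :
    ∃ r₀ ∈ Ioc a b, f r₀ = 0 ∧ ∀ r ∈ Ico a r₀, 0 < f r := by
  have hS : IsCompact (Icc a b ∩ f ⁻¹' Iic 0) :=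
    isCompact_Icc.of_isClosed_subset (hf.preimage_isClosed_of_isClosed isClosed_Icc isClosed_Iic)
      inter_subset_left
  obtain ⟨r₀, ⟨hr₀, hfr₀⟩, hleast⟩ := hS.exists_isLeast ⟨x, hx, hfx⟩
  have hpos : ∀ r ∈ Ico a r₀, 0 < f r := fun r hr => by
    by_contra! h
    exact absurd (hleast ⟨⟨hr.1, hr.2.le.trans hr₀.2⟩, h⟩) (not_le.2 hr.2)
  have hlt : a < r₀ := lt_of_le_of_ne hr₀.1 fun h => by
    rw [← h] at hfr₀
    exact absurd hfr₀ (not_le.2 ha)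
  obtain ⟨z, hz, hfz⟩ := intermediate_value_Icc' hlt.le
    (hf.mono (Icc_subset_Icc le_rfl hr₀.2)) ⟨hfr₀, ha.le⟩
  have : z = r₀ := by
    by_contra hne
    have := hpos z ⟨hz.1, lt_of_le_of_ne hz.2 hne⟩
    linarith
  exact ⟨r₀, ⟨hlt, hr₀.2⟩, this ▸ hfz, hpos⟩

namespace IsFluxSolution

variable {p g φ φ₁ : ℝ → ℝ} {a b : ℝ}

/-- The flux starts at zero and increases because its derivative `p g` is positive. Positivity of
`p` is not needed at `a`, where the radial weight may vanish. -/
theorem flux_pos (H : IsFluxSolution p g a b φ φ₁) (hp : ContinuousOn p (Icc a b))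
    (hpos : ∀ r ∈ Ioc a b, 0 < p r) (hg : ∀ r ∈ Ioo a b, 0 < g r) (ha : φ₁ a = 0) :
    ∀ r ∈ Ioc a b, 0 < φ₁ r := by
  intro r hr
  obtain ⟨ξ, hξ, h⟩ := H.exists_flux_sub_eq hp le_rfl hr.1 hr.2
  rw [ha, mul_zero, sub_zero] at h
  have h1 : 0 < p r * φ₁ r := by
    rw [h]
    exact mul_pos (mul_pos (hpos ξ ⟨hξ.1, hξ.2.le.trans hr.2⟩) (hg ξ ⟨hξ.1, hξ.2.trans_le hr.2⟩))
      (sub_pos.2 hr.1)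
  exact (pos_iff_pos_of_mul_pos h1).1 (hpos r hr)

theorem neg (H : IsFluxSolution p g a b φ φ₁) :
    IsFluxSolution p (fun r => -g r) a b (fun r => -φ r) (fun r => -φ₁ r) where
  continuousOn := H.continuousOn.neg
  continuousOn_deriv := H.continuousOn_deriv.neg
  hasDerivAt r hr := (H.hasDerivAt r hr).fun_neg
  hasDerivAt_flux r hr := by simpa using (H.hasDerivAt_flux r hr).fun_neg

end IsFluxSolution

/-- Existence of a principal eigenvalue of `(p φ')' = p (c - μ) φ` under Neumann conditions, with
an eigenfunction that is positive up to the boundary. -/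
theorem exists_neumann_solution {p c : ℝ → ℝ} {a b M : ℝ} (hab : a < b) (hp : Continuous p)
    (hpos : ∀ r ∈ Ioc a b, 0 < p r) (hM0 : 0 ≤ M)
    (hM : ∀ r ∈ Icc a b, ∀ t ∈ Icc a b, r ≤ t → p r ≤ M * p t) (hc : Continuous c) :
    ∃ (μ : ℝ) (φ φ₁ : ℝ → ℝ), Continuous φ₁ ∧ (∀ r, HasDerivAt φ (φ₁ r) r) ∧
      IsFluxSolution p (fun r => (c r - μ) * φ r) a b φ φ₁ ∧
      (∀ r ∈ Icc a b, 0 < φ r) ∧ φ₁ a = 0 ∧ φ₁ b = 0 := by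
  obtain ⟨K, hK⟩ := isCompact_Icc.exists_bound_of_continuousOn (hc.continuousOn (s := Icc a b))
  have hK0 : 0 ≤ K := (norm_nonneg _).trans (hK a (left_mem_Icc.2 hab.le))
  have hKle : ∀ r ∈ Icc a b, -K ≤ c r ∧ c r ≤ K := fun r hr => abs_le.1 (hK r hr)
  -- The extra `1` makes `c - μ` strictly positive for `μ = -L` and strictly negative for `μ = L`.
  set L := K + 1 with hL
  obtain ⟨Φ, Φ₁, hsol, hunif, hbc⟩ := exists_shooting_family hab hp hpos hM0 hM hc (-L) L
  have hle : -L ≤ L := by linarith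
  have haI := left_mem_Icc.2 hab.le
  have hbI := right_mem_Icc.2 hab.le
  by_contra hno
  -- Continuity method. Without an eigenvalue, `G` is closed in `[-L, L]`, contains `-L` and is open
  -- to the right, so it contains `L`; but at `μ = L` a positive solution ends with negative flux.
  set G : Set ℝ := {μ | (∀ r ∈ Icc a b, 0 < Φ μ r) ∧ 0 < Φ₁ μ b} with hG
  have hsub : Icc (-L) L ⊆ G := by
    refine IsClosed.Icc_subset_of_forall_mem_nhdsWithin ?_ ?_ ?_
    · rw [← isSeqClosed_iff_isClosed]
      intro x μ hx hμ
      have hμI : μ ∈ Icc (-L) L := isClosed_Icc.mem_of_tendsto hμ (.of_forall fun n => (hx n).2)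
      have hμ' : Tendsto x atTop (𝓝[Icc (-L) L] μ) :=
        tendsto_nhdsWithin_iff.2 ⟨hμ, .of_forall fun n => (hx n).2⟩
      obtain ⟨h1, h2, h3, h4, h5⟩ := hsol μ hμI
      have hnn : ∀ r ∈ Icc a b, 0 ≤ Φ μ r := fun r hr =>
        ge_of_tendsto (((hunif μ hμI).tendsto_at hr).comp hμ')
          (.of_forall fun n => ((hx n).1.1 r hr).le)
      have hb : 0 ≤ Φ₁ μ b := ge_of_tendsto ((hbc μ hμI).tendsto.comp hμ')
          (.of_forall fun n => (hx n).1.2.le)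
      have hposμ : ∀ r ∈ Icc a b, 0 < Φ μ r := by
        by_contra! hcon
        obtain ⟨y, hy, hy0⟩ := hcon
        obtain ⟨r₀, hr₀, hz, hbefore⟩ :=
          exists_first_zero h5.continuousOn (by rw [h1]; exact one_pos) hy hy0
        -- The Hopf lemma needs a weight positive on a closed interval, so it is applied away from
        -- `a`.
        have hmid : a < (a + r₀) / 2 := by linarith [hr₀.1]
        have hmid' : (a + r₀) / 2 < r₀ := by linarith [hr₀.1]
        have hneg : Φ₁ μ r₀ < 0 := by
          refine (h5.mono hmid.le hr₀.2).deriv_right_neg (K := K + |μ|) hp.continuousOn hmid'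
            (fun r hr => hpos r ⟨hmid.trans_le hr.1, hr.2.trans hr₀.2⟩) (fun r hr => ?_)
            (fun r hr => hbefore r ⟨hmid.le.trans hr.1.le, hr.2⟩) hz
          have := hK r ⟨hmid.le.trans hr.1, hr.2.trans hr₀.2⟩
          rw [Real.norm_eq_abs] at this
          exact (abs_sub _ _).trans (by linarith)
        -- A negative slope at the first zero contradicts the nonnegative limit flux if the zero is
        -- `b`, and the nonnegativity of the limit solution if it is interior.
        rcases eq_or_lt_of_le hr₀.2 with rfl | hlt
        · linarith
        · have hmin : IsLocalMin (Φ μ) r₀ := by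
            filter_upwards [Ioo_mem_nhds hr₀.1 hlt] with t ht
            rw [hz]
            exact hnn t (Ioo_subset_Icc_self ht)
          rw [hmin.hasDerivAt_eq_zero (h4 r₀)] at hneg
          exact lt_irrefl _ hneg
      refine ⟨⟨hposμ, lt_of_le_of_ne hb fun h => hno ?_⟩, hμI⟩
      exact ⟨μ, Φ μ, Φ₁ μ, h3, h4, h5, hposμ, h2, h.symm⟩
    · obtain ⟨h1, h2, -, -, h5⟩ := hsol (-L) (left_mem_Icc.2 hle)
      have hk : ∀ r ∈ Icc a b, 0 < c r - -L := fun r hr => by linarith [(hKle r hr).1]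
      have hpos' : ∀ r ∈ Icc a b, 0 < Φ (-L) r := by
        by_contra! hcon
        obtain ⟨y, hy, hy0⟩ := hcon
        obtain ⟨r₀, hr₀, hz, hbefore⟩ :=
          exists_first_zero h5.continuousOn (by rw [h1]; exact one_pos) hy hy0
        have h6 := (h5.mono le_rfl hr₀.2).flux_pos hp.continuousOn
          (fun r hr => hpos r ⟨hr.1, hr.2.trans hr₀.2⟩)
          (fun r hr => mul_pos (hk r ⟨hr.1.le, hr.2.le.trans hr₀.2⟩)
            (hbefore r ⟨hr.1.le, hr.2⟩)) h2
        obtain ⟨ξ, hξ, h7⟩ := h5.exists_sub_eq le_rfl hr₀.1 hr₀.2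
        have := mul_pos (h6 ξ ⟨hξ.1, hξ.2.le⟩) (sub_pos.2 hr₀.1)
        rw [hz, h1] at h7
        linarith
      refine ⟨hpos', h5.flux_pos hp.continuousOn hpos (fun r hr => ?_) h2 b ⟨hab, le_rfl⟩⟩
      have hr' := Ioo_subset_Icc_self hr
      exact mul_pos (hk r hr') (hpos' r hr')
    · rintro μ ⟨⟨hμ1, hμ2⟩, hμ⟩
      have hμI := Ico_subset_Icc_self hμ
      obtain ⟨-, -, -, -, h5⟩ := hsol μ hμI
      obtain ⟨y, hy, hymin⟩ := isCompact_Icc.exists_isMinOn ⟨a, haI⟩ h5.continuousOn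
      have e1 := Metric.tendstoUniformlyOn_iff.1 (hunif μ hμI) (Φ μ y) (hμ1 y hy)
      have e2 : ∀ᶠ ν in 𝓝[Icc (-L) L] μ, 0 < Φ₁ ν b :=
        (hbc μ hμI).tendsto.eventually_const_lt hμ2
      have hfil : 𝓝[>] μ ≤ 𝓝[Icc (-L) L] μ := by
        rw [← nhdsWithin_Ioo_eq_nhdsGT hμ.2]
        exact nhdsWithin_mono _ fun t ht => ⟨hμ.1.trans ht.1.le, ht.2.le⟩
      refine hfil ?_
      filter_upwards [e1, e2] with ν h1 h2
      refine ⟨fun r hr => ?_, h2⟩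
      have h3 := h1 r hr
      rw [Real.dist_eq] at h3
      have h4 : Φ μ y ≤ Φ μ r := hymin hr
      linarith [(abs_lt.1 h3).2]
  obtain ⟨h1, h2⟩ := hsub (right_mem_Icc.2 hle)
  obtain ⟨-, h3, -, -, h5⟩ := hsol L (right_mem_Icc.2 hle)
  have := h5.neg.flux_pos hp.continuousOn hpos (fun r hr => ?_) (by simpa using h3) b
    ⟨hab, le_rfl⟩
  · linarith
  · have hr' := Ioo_subset_Icc_self hr
    have := mul_pos (sub_pos.2 (lt_of_le_of_lt (hKle r hr').2 (lt_add_one K))) (h1 r hr')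
    linarith

/-! ### Translation between classical eigenfunctions and the divergence form -/

section Eigenfunction

variable {d : ℕ} {v c p φ φ₁ : ℝ → ℝ} {a b μ ν : ℝ} {A B : BoundaryType}

theorem IsPositiveEigenfunction.congr_potential {c' : ℝ → ℝ}
    (H : IsPositiveEigenfunction d v c a b A B μ φ) (h : ∀ r ∈ Ioo a b, c' r = c r) :
    IsPositiveEigenfunction d v c' a b A B μ φ where
  contDiffOn_closed := H.contDiffOn_closed
  contDiffOn_open := H.contDiffOn_open
  equation r hr := by rw [h r hr]; exact H.equation r hr
  left := H.left
  right := H.right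
  pos := H.pos

theorem isPrincipalEigenvalue_congr {c' : ℝ → ℝ} (h : ∀ r ∈ Ioo a b, c' r = c r) :
    IsPrincipalEigenvalue d v c' a b A B μ ↔ IsPrincipalEigenvalue d v c a b A B μ :=
  ⟨fun ⟨φ, H⟩ => ⟨φ, H.congr_potential fun r hr => (h r hr).symm⟩,
    fun ⟨φ, H⟩ => ⟨φ, H.congr_potential h⟩⟩

/-- The weight `p` is an integrating factor: `p' / p` is exactly the coefficient of `-φ'` in the
operator. -/
theorem IsPositiveEigenfunction.isFluxSolution (H : IsPositiveEigenfunction d v c a b A B μ φ)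
    (hab : a < b) (hw : ∀ r ∈ Ioo a b, HasDerivAt p ((((d : ℝ) - 1) / r + v r) * p r) r) :
    IsFluxSolution p (fun r => (c r - μ) * φ r) a b φ (derivWithin φ (Icc a b)) := by
  have hdw : ∀ r ∈ Ioo a b, derivWithin φ (Icc a b) r = deriv φ r := fun r hr =>
    derivWithin_of_mem_nhds (Icc_mem_nhds hr.1 hr.2)
  refine ⟨H.contDiffOn_closed.continuousOn,
    H.contDiffOn_closed.continuousOn_derivWithin (uniqueDiffOn_Icc hab) le_rfl,
    fun r hr => ?_, fun r hr => ?_⟩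
  · rw [hdw r hr]
    exact ((H.contDiffOn_closed.differentiableOn one_ne_zero).differentiableAt
      (Icc_mem_nhds hr.1 hr.2)).hasDerivAt
  · have h2 := (contDiffOn_succ_iff_deriv_of_isOpen (n := 1) isOpen_Ioo).1
      (by simpa using (by exact_mod_cast H.contDiffOn_open : ContDiffOn ℝ (1 + 1) φ (Ioo a b)))
    have h3 : HasDerivAt (deriv φ) (deriv (deriv φ) r) r :=
      ((h2.2.2.differentiableOn one_ne_zero).differentiableAt
        (Ioo_mem_nhds hr.1 hr.2)).hasDerivAt
    have h4 := (hw r hr).mul h3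
    have h5 : HasDerivAt (fun t => p t * derivWithin φ (Icc a b) t)
        ((((d : ℝ) - 1) / r + v r) * p r * deriv φ r + p r * deriv (deriv φ) r) r := by
      refine h4.congr_of_eventuallyEq ?_
      filter_upwards [Ioo_mem_nhds hr.1 hr.2] with t ht
      simp only [Pi.mul_apply, hdw t ht]
    refine h5.congr_deriv ?_
    have := H.equation r hr
    linear_combination (-p r) * this

/-- Second-order regularity comes from writing `φ₁` as flux divided by weight: both are
differentiable in the interior, and the resulting formula for `φ''` is continuous there. -/
theorem IsFluxSolution.isPositiveEigenfunction
    (H : IsFluxSolution p (fun r => (c r - μ) * φ r) a b φ φ₁) (hab : a < b) (ha0 : 0 ≤ a)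
    (hφ : ∀ r, HasDerivAt φ (φ₁ r) r) (hφ₁ : Continuous φ₁) (hc : Continuous c)
    (hv : ContinuousOn v (Ioo a b)) (hp : ∀ r ∈ Ioo a b, 0 < p r)
    (hw : ∀ r ∈ Ioo a b, HasDerivAt p ((((d : ℝ) - 1) / r + v r) * p r) r)
    (hpos : ∀ r ∈ Ioo a b, 0 < φ r) (ha : φ₁ a = 0) (hb : φ₁ b = 0) :
    IsPositiveEigenfunction d v c a b .neumann .neumann μ φ := by
  have hder : deriv φ = φ₁ := funext fun r => (hφ r).deriv
  have hdiff : Differentiable ℝ φ := fun r => (hφ r).differentiableAt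
  have hC1 : ContDiff ℝ 1 φ := contDiff_one_iff_deriv.2 ⟨hdiff, hder ▸ hφ₁⟩
  have hφ₂ : ∀ r ∈ Ioo a b, HasDerivAt φ₁
      ((c r - μ) * φ r - (((d : ℝ) - 1) / r + v r) * φ₁ r) r := fun r hr => by
    have hpr := (hp r hr).ne'
    have h1 := (H.hasDerivAt_flux r hr).div (hw r hr) hpr
    have h2 : HasDerivAt φ₁ ((p r * ((c r - μ) * φ r) * p r -
        p r * φ₁ r * ((((d : ℝ) - 1) / r + v r) * p r)) / p r ^ 2) r := by
      refine h1.congr_of_eventuallyEq ?_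
      filter_upwards [Ioo_mem_nhds hr.1 hr.2] with t ht
      simp only [Pi.div_apply]
      rw [mul_div_cancel_left₀ _ (hp t ht).ne']
    refine h2.congr_deriv ?_
    field_simp
  have hbd : ∀ e ∈ Icc a b, derivWithin φ (Icc a b) e = φ₁ e := fun e he =>
    (hφ e).hasDerivWithinAt.derivWithin (uniqueDiffOn_Icc hab e he)
  refine ⟨hC1.contDiffOn, ?_, fun r hr => ?_, ?_, ?_, hpos⟩
  · have key : ContDiffOn ℝ (1 + 1) φ (Ioo a b) := by
      rw [contDiffOn_succ_iff_deriv_of_isOpen isOpen_Ioo, hder]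
      refine ⟨hdiff.differentiableOn, by simp, ?_⟩
      rw [← zero_add 1, contDiffOn_succ_iff_deriv_of_isOpen isOpen_Ioo]
      refine ⟨fun r hr => (hφ₂ r hr).differentiableAt.differentiableWithinAt, by simp, ?_⟩
      rw [contDiffOn_zero]
      have hcont : ContinuousOn (fun r => (c r - μ) * φ r -
          (((d : ℝ) - 1) / r + v r) * φ₁ r) (Ioo a b) := by
        have h1 : ContinuousOn (fun r : ℝ => ((d : ℝ) - 1) / r) (Ioo a b) :=
          continuousOn_const.div continuousOn_id fun r hr => (ha0.trans_lt hr.1).ne'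
        exact (((hc.sub continuous_const).mul hdiff.continuous).continuousOn).sub
          ((h1.add hv).mul hφ₁.continuousOn)
      exact hcont.congr fun r hr => (hφ₂ r hr).deriv
    exact_mod_cast key
  · rw [hder, (hφ₂ r hr).deriv]
    ring
  · exact (hbd a (left_mem_Icc.2 hab.le)).trans ha
  · exact (hbd b (right_mem_Icc.2 hab.le)).trans hb

/-- Existence of the principal Neumann eigenvalue. -/
theorem exists_neumann_eigenfunction {M : ℝ} (hab : a < b) (ha0 : 0 ≤ a) (hp : Continuous p)
    (hpos : ∀ r ∈ Ioc a b, 0 < p r) (hM0 : 0 ≤ M)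
    (hM : ∀ r ∈ Icc a b, ∀ t ∈ Icc a b, r ≤ t → p r ≤ M * p t) (hc : Continuous c)
    (hv : ContinuousOn v (Ioo a b))
    (hw : ∀ r ∈ Ioo a b, HasDerivAt p ((((d : ℝ) - 1) / r + v r) * p r) r) :
    ∃ (μ : ℝ) (φ : ℝ → ℝ), IsPositiveEigenfunction d v c a b .neumann .neumann μ φ ∧
      ∀ r ∈ Icc a b, 0 < φ r := by
  obtain ⟨μ, φ, φ₁, h1, h2, h3, h4, h5, h6⟩ := exists_neumann_solution hab hp hpos hM0 hM hc
  exact ⟨μ, φ, h3.isPositiveEigenfunction hab ha0 h2 h1 hc hv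
    (fun r hr => hpos r (Ioo_subset_Ioc_self hr)) hw
    (fun r hr => h4 r (Ioo_subset_Icc_self hr)) h5 h6, h4⟩

/-- Uniqueness of the principal Neumann eigenvalue. -/
theorem IsPrincipalEigenvalue.le_of_neumann (hab : a < b) (hp : Continuous p)
    (hpos : ∀ r ∈ Ioo a b, 0 < p r)
    (hw : ∀ r ∈ Ioo a b, HasDerivAt p ((((d : ℝ) - 1) / r + v r) * p r) r)
    (hμ : IsPrincipalEigenvalue d v c a b .neumann .neumann μ)
    (hν : IsPrincipalEigenvalue d v c a b .neumann .neumann ν) : μ ≤ ν := by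
  obtain ⟨φ, hφ⟩ := hμ
  obtain ⟨ψ, hψ⟩ := hν
  by_contra! hlt
  have h1 := hψ.isFluxSolution hab hw
  have h2 := hφ.isFluxSolution hab hw
  have h3 := h1.wronskian_lt h2 hp.continuousOn hab fun r hr => by
    have := mul_pos (mul_pos (hpos r hr) (sub_pos.2 hlt)) (mul_pos (hφ.pos r hr) (hψ.pos r hr))
    linarith
  have e1 : derivWithin φ (Icc a b) a = 0 := hφ.left
  have e2 : derivWithin ψ (Icc a b) a = 0 := hψ.left
  have e3 : derivWithin φ (Icc a b) b = 0 := hφ.right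
  have e4 : derivWithin ψ (Icc a b) b = 0 := hψ.right
  rw [e1, e2, e3, e4] at h3
  simp at h3

theorem hasDerivAt_radialWeight (hd : 1 ≤ d) {q : ℝ → ℝ} {q' r : ℝ} (hr : 0 < r)
    (hq : HasDerivAt q q' r) :
    HasDerivAt (fun r => r ^ (d - 1) * Real.exp (q r))
      ((((d : ℝ) - 1) / r + q') * (r ^ (d - 1) * Real.exp (q r))) r := by
  have h1 := (hasDerivAt_pow (d - 1) r).mul hq.exp
  refine h1.congr_deriv ?_
  obtain ⟨n, rfl⟩ : ∃ n, d = n + 1 := ⟨d - 1, by omega⟩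
  rcases n with _ | n
  · simp
    ring
  · simp only [Nat.add_sub_cancel]
    push_cast
    rw [pow_succ r n]
    field_simp
    ring

end Eigenfunction

/-! ### The oscillating profile and its peaks -/

/-- The slowly varying phase of the oscillation. -/
noncomputable def oscPhase (x : ℝ) : ℝ := Real.log (1 + Real.log x ^ 2)

/-- A `C¹` function on the line that vanishes on `(-∞, 0]` and changes sign infinitely often
at `0+`. -/
noncomputable def osc (x : ℝ) : ℝ := if 0 < x then x ^ 2 * Real.sin (oscPhase x) else 0

/-- The derivative of `osc`. -/
noncomputable def oscDeriv (x : ℝ) : ℝ :=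
  if 0 < x then 2 * x * Real.sin (oscPhase x) +
    x * (Real.cos (oscPhase x) * (2 * Real.log x / (1 + Real.log x ^ 2))) else 0

theorem osc_of_pos {x : ℝ} (hx : 0 < x) : osc x = x ^ 2 * Real.sin (oscPhase x) := if_pos hx

theorem osc_of_nonpos {x : ℝ} (hx : x ≤ 0) : osc x = 0 := if_neg (not_lt.2 hx)

theorem abs_osc_le (x : ℝ) : |osc x| ≤ x ^ 2 := by
  unfold osc
  split_ifs
  · rw [abs_mul, abs_of_nonneg (sq_nonneg x)]
    exact mul_le_of_le_one_right (sq_nonneg x) (Real.abs_sin_le_one _)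
  · simpa using sq_nonneg x

theorem abs_oscDeriv_le (x : ℝ) : |oscDeriv x| ≤ 3 * |x| := by
  unfold oscDeriv
  split_ifs with hx
  · have h1 : |2 * Real.log x / (1 + Real.log x ^ 2)| ≤ 1 := by
      rw [abs_div, abs_of_pos (by positivity : 0 < 1 + Real.log x ^ 2),
        div_le_one (by positivity), abs_le]
      constructor
      · nlinarith [sq_nonneg (Real.log x + 1)]
      · nlinarith [sq_nonneg (Real.log x - 1)]
    have h2 : |Real.cos (oscPhase x) * (2 * Real.log x / (1 + Real.log x ^ 2))| ≤ 1 := by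
      rw [abs_mul]
      exact mul_le_one₀ (Real.abs_cos_le_one _) (abs_nonneg _) h1
    calc _ ≤ |2 * x * Real.sin (oscPhase x)| + _ := abs_add_le _ _
      _ ≤ 2 * |x| * 1 + |x| * 1 := by
        rw [abs_mul, abs_mul, abs_mul x, abs_two]
        gcongr
        exact Real.abs_sin_le_one _
      _ = 3 * |x| := by ring
  · simp

theorem hasDerivAt_osc (x : ℝ) : HasDerivAt osc (oscDeriv x) x := by
  rcases lt_trichotomy x 0 with hx | rfl | hx
  · have h0 : oscDeriv x = 0 := if_neg (not_lt.2 hx.le)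
    rw [h0]
    refine (hasDerivAt_const x 0).congr_of_eventuallyEq ?_
    filter_upwards [Iio_mem_nhds hx] with t ht
    exact osc_of_nonpos (le_of_lt ht)
  · have h0 : oscDeriv 0 = 0 := if_neg (lt_irrefl _)
    rw [h0, hasDerivAt_iff_isLittleO]
    simp only [osc_of_nonpos le_rfl, sub_zero, smul_zero]
    have h1 : osc =O[𝓝 0] fun x : ℝ => x ^ 2 :=
      .of_bound 1 (.of_forall fun x => by
        rw [one_mul, Real.norm_eq_abs, Real.norm_eq_abs, abs_of_nonneg (sq_nonneg x)]
        exact abs_osc_le x)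
    refine h1.trans_isLittleO ?_
    simpa using Asymptotics.isLittleO_pow_pow (𝕜 := ℝ) (one_lt_two)
  · have hl : HasDerivAt (fun t => 1 + Real.log t ^ 2) (2 * Real.log x * x⁻¹) x := by
      have := ((Real.hasDerivAt_log hx.ne').pow 2).const_add 1
      exact this.congr_deriv (by simp)
    have h1 := (hasDerivAt_pow 2 x).mul
      (hl.log (by positivity : (0 : ℝ) < 1 + Real.log x ^ 2).ne').sin
    have h2 : HasDerivAt osc _ x := h1.congr_of_eventuallyEq (by
      filter_upwards [Ioi_mem_nhds hx] with t ht
      exact osc_of_pos ht)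
    refine h2.congr_deriv ?_
    rw [oscDeriv, if_pos hx, oscPhase]
    have : 1 + Real.log x ^ 2 ≠ 0 := by positivity
    field_simp
    ring

theorem continuous_oscDeriv : Continuous oscDeriv := by
  rw [continuous_iff_continuousAt]
  intro x
  rcases lt_trichotomy x 0 with hx | rfl | hx
  · refine (continuousAt_const (y := (0 : ℝ))).congr ?_
    filter_upwards [Iio_mem_nhds hx] with t ht
    exact (if_neg (not_lt.2 (le_of_lt ht))).symm
  · have h0 : oscDeriv 0 = 0 := if_neg (lt_irrefl _)
    rw [ContinuousAt, h0]
    refine squeeze_zero_norm abs_oscDeriv_le ?_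
    have : Tendsto (fun x : ℝ => 3 * |x|) (𝓝 0) (𝓝 (3 * |0|)) :=
      Continuous.tendsto (by fun_prop) 0
    simpa using this
  · have hpos : (1 : ℝ) + Real.log x ^ 2 ≠ 0 := by positivity
    have hlog : ContinuousAt Real.log x := Real.continuousAt_log hx.ne'
    have hph : ContinuousAt oscPhase x :=
      (continuousAt_const.add (hlog.pow 2)).log hpos
    have : ContinuousAt (fun x => 2 * x * Real.sin (oscPhase x) +
        x * (Real.cos (oscPhase x) * (2 * Real.log x / (1 + Real.log x ^ 2)))) x := by
      refine ((continuousAt_const.mul continuousAt_id).mul (Real.continuous_sin.continuousAt.comp hph)).add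
        (continuousAt_id.mul ((Real.continuous_cos.continuousAt.comp hph).mul ((continuousAt_const.mul hlog).div
          (continuousAt_const.add (hlog.pow 2)) hpos)))
    refine this.congr ?_
    filter_upwards [Ioi_mem_nhds hx] with t ht
    exact (if_pos ht).symm

/-- Arbitrarily close to `0` there are scales `x` at which the oscillation with phase shift `α` is
of order `x ^ 2` while it is at least `-x ^ 4` on all of `(0, x]`. -/
theorem exists_osc_peak (α : ℝ) {ε : ℝ} (hε : 0 < ε) :
    ∃ x, 0 < x ∧ x < ε ∧
      (∀ t ∈ Icc (x / 2) x, x ^ 2 / 8 ≤ t ^ 2 * Real.sin (oscPhase t + α)) ∧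
      (∀ t ∈ Ioc 0 x, -x ^ 4 ≤ t ^ 2 * Real.sin (oscPhase t + α)) := by
  set R := |Real.log ε| + 1 with hR
  have hR1 : 1 ≤ R := by linarith [abs_nonneg (Real.log ε)]
  obtain ⟨n, hn⟩ := exists_nat_ge (R ^ 2 + |α|)
  -- At phase `θ` the shifted sine equals `1`. Solving `1 + L ^ 2 = exp θ` and taking `x = exp (-L)`
  -- places this phase at `x`; a large `n` makes `x` small.
  set θ := n * (2 * Real.pi) + Real.pi / 2 - α with hθ
  have hθR : R ^ 2 ≤ θ := by
    have : (n : ℝ) * 1 ≤ n * (2 * Real.pi) := by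
      gcongr
      linarith [Real.pi_gt_three]
    linarith [le_abs_self α, Real.pi_pos]
  have hexp : R ^ 2 ≤ Real.exp θ - 1 := by linarith [Real.add_one_le_exp θ]
  set L := √(Real.exp θ - 1) with hLdef
  have hLR : R ≤ L := Real.le_sqrt_of_sq_le hexp
  have hL1 : 1 ≤ L := hR1.trans hLR
  have hLsq : 1 + L ^ 2 = Real.exp θ := by
    rw [Real.sq_sqrt (by nlinarith)]
    ring
  set x := Real.exp (-L) with hx
  have hx0 : 0 < x := Real.exp_pos _
  have hlogx : Real.log x = -L := Real.log_exp _
  have hxε : x < ε := by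
    rw [← Real.log_lt_log_iff hx0 hε, hlogx]
    linarith [neg_abs_le (Real.log ε)]
  have hphase : ∀ t ∈ Ioc 0 x, L ≤ -Real.log t ∧ θ ≤ oscPhase t := by
    intro t ht
    have h1 : L ≤ -Real.log t := by
      have := Real.log_le_log ht.1 ht.2
      linarith
    refine ⟨h1, ?_⟩
    rw [oscPhase, Real.le_log_iff_exp_le (by positivity), ← hLsq]
    nlinarith
  refine ⟨x, hx0, hxε, fun t ht => ?_, fun t ht => ?_⟩
  · have ht0 : 0 < t := (half_pos hx0).trans_le ht.1
    obtain ⟨h1, h2⟩ := hphase t ⟨ht0, ht.2⟩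
    -- Since `log 2 < 0.7` and `1 + (L + 0.7) ^ 2 ≤ 2.7 * (1 + L ^ 2)`, the phase grows by at most
    -- `1` on `[x / 2, x]`, which keeps the cosine above `1 / 2`.
    have h3 : -Real.log t ≤ L + 0.7 := by
      have := Real.log_le_log (half_pos hx0) ht.1
      rw [Real.log_div hx0.ne' two_ne_zero, hlogx] at this
      linarith [Real.log_two_lt_d9]
    have h4 : oscPhase t ≤ θ + 1 := by
      rw [oscPhase, Real.log_le_iff_le_exp (by positivity), Real.exp_add, ← hLsq]
      have : Real.log t ^ 2 ≤ (L + 0.7) ^ 2 := by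
        rw [← neg_sq]
        exact pow_le_pow_left₀ (by linarith) h3 2
      have h5 : (1 + L ^ 2) * 2.7 ≤ (1 + L ^ 2) * Real.exp 1 := by
        gcongr
        linarith [Real.exp_one_gt_d9]
      nlinarith [sq_nonneg (L - 1)]
    have h5 : Real.sin (oscPhase t + α) = Real.cos (oscPhase t - θ) := by
      rw [← Real.cos_sub_pi_div_two, ← Real.cos_sub_nat_mul_two_pi _ n]
      congr 1
      rw [hθ]
      ring
    have h6 : 1 / 2 ≤ Real.sin (oscPhase t + α) := by
      rw [h5]
      have := Real.one_sub_sq_div_two_le_cos (x := oscPhase t - θ)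
      nlinarith
    have h7 : (x / 2) ^ 2 ≤ t ^ 2 := pow_le_pow_left₀ (by positivity) ht.1 2
    nlinarith
  · obtain ⟨h1, h2⟩ := hphase t ht
    -- The sine stays nonnegative for a quarter period after `θ`. Beyond that, `1 + log t ^ 2` has
    -- grown by a factor `exp (π / 2) ≥ 4`, so `|log t| ≥ 2 L`, that is `t ≤ x ^ 2`, and the
    -- amplitude `t ^ 2` is at most `x ^ 4`.
    rcases le_or_gt (oscPhase t) (θ + Real.pi / 2) with h3 | h3
    · have h5 : Real.sin (oscPhase t + α) = Real.sin (oscPhase t + α - n * (2 * Real.pi)) := by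
        rw [Real.sin_sub_nat_mul_two_pi]
      have h6 : 0 ≤ Real.sin (oscPhase t + α) := by
        rw [h5]
        refine Real.sin_nonneg_of_nonneg_of_le_pi ?_ ?_ <;> linarith [Real.pi_pos]
      have : 0 ≤ t ^ 2 * Real.sin (oscPhase t + α) := by positivity
      have : 0 ≤ x ^ 4 := by positivity
      linarith
    · rw [oscPhase, Real.lt_log_iff_exp_lt (by positivity), Real.exp_add, ← hLsq] at h3
      have h4 : 4 ≤ Real.exp (Real.pi / 2) := by
        have e1 : Real.exp 1 * Real.exp (1 / 2) ≤ Real.exp (Real.pi / 2) := by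
          rw [← Real.exp_add]
          refine Real.exp_le_exp.2 ?_
          linarith [Real.pi_gt_three]
        nlinarith [Real.exp_one_gt_d9, Real.add_one_le_exp (1 / 2 : ℝ)]
      have h5 : (2 * L) ^ 2 ≤ (-Real.log t) ^ 2 := by nlinarith
      have h6 : 2 * L ≤ -Real.log t := le_of_sq_le_sq h5 (by linarith)
      have h7 : t ≤ x ^ 2 := by
        rw [← Real.log_le_log_iff ht.1 (by positivity), Real.log_pow, hlogx]
        push_cast
        linarith
      have h8 : t ^ 2 ≤ x ^ 4 := by
        calc t ^ 2 ≤ (x ^ 2) ^ 2 := pow_le_pow_left₀ ht.1.le h7 2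
          _ = x ^ 4 := by ring
      nlinarith [Real.neg_one_le_sin (oscPhase t + α), sq_nonneg t]

/-! ### Barrier estimates on an outer interval -/

namespace IsFluxSolution

section Barrier

variable {p k φ φ₁ : ℝ → ℝ} {a e x : ℝ}

theorem le_of_flux_pos {g : ℝ → ℝ} (H : IsFluxSolution p g a e φ φ₁)
    (h : ∀ r ∈ Ioc a e, 0 < φ₁ r) {r t : ℝ} (hr : a ≤ r) (hrt : r ≤ t) (ht : t ≤ e) :
    φ r ≤ φ t := by
  rcases eq_or_lt_of_le hrt with rfl | hlt
  · exact le_rfl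
  obtain ⟨ξ, hξ, h1⟩ := H.exists_sub_eq hr hlt ht
  have := mul_pos (h ξ ⟨hr.trans_lt hξ.1, hξ.2.le.trans ht⟩) (sub_pos.2 hlt)
  linarith

theorem flux_le_flux {g : ℝ → ℝ} (H : IsFluxSolution p g a e φ φ₁)
    (hp : ContinuousOn p (Icc a e)) (hpos : ∀ r ∈ Ioc a e, 0 < p r)
    (hg : ∀ r ∈ Ioo a e, 0 < g r) {r t : ℝ} (hr : a ≤ r) (hrt : r ≤ t) (ht : t ≤ e) :
    p r * φ₁ r ≤ p t * φ₁ t := by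
  rcases eq_or_lt_of_le hrt with rfl | hlt
  · exact le_rfl
  obtain ⟨ξ, hξ, h1⟩ := H.exists_flux_sub_eq hp hr hlt ht
  have := mul_pos (mul_pos (hpos ξ ⟨hr.trans_lt hξ.1, hξ.2.le.trans ht⟩)
    (hg ξ ⟨hr.trans_lt hξ.1, hξ.2.trans_le ht⟩)) (sub_pos.2 hlt)
  linarith

/-- If the weight is small on `[e - x, e - x / 2]` and bounded on `[e - x, e]`, then the
logarithmic derivative of `φ` at `e` is small. -/
theorem flux_le_of_small_weight {P δ K : ℝ}
    (H : IsFluxSolution p (fun r => k r * φ r) a e φ φ₁) (hp : ContinuousOn p (Icc a e))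
    (hpos : ∀ r ∈ Ioc a e, 0 < p r) (hk : ∀ r ∈ Ioo a e, 0 < k r) (hkK : ∀ r ∈ Ioo a e, k r ≤ K)
    (hφ : ∀ r ∈ Ioc a e, 0 < φ r) (ha : φ₁ a = 0) (hx : 0 < x) (hax : a < e - x)
    (hP : ∀ r ∈ Icc (e - x) e, p r ≤ P) (hδ : ∀ r ∈ Icc (e - x) (e - x / 2), p r ≤ δ) :
    p e * φ₁ e ≤ φ e * (2 * δ / x + P * K * x) := by
  have hg : ∀ r ∈ Ioo a e, 0 < k r * φ r := fun r hr => mul_pos (hk r hr) (hφ r ⟨hr.1, hr.2.le⟩)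
  have hφ₁ := H.flux_pos hp hpos hg ha
  -- As `φ` is increasing, its slope somewhere on the far half is at most `2 φ(e) / x`, so the flux
  -- there is at most `2 δ φ(e) / x`; from there to `e` the flux gains at most `P K φ(e) x`.
  obtain ⟨ξ, hξ, h1⟩ := H.exists_sub_eq hax.le (by linarith : e - x < e - x / 2) (by linarith)
  have haξ : a < ξ := hax.trans hξ.1
  have hξe : ξ < e := hξ.2.trans (by linarith)
  obtain ⟨ζ, hζ, h2⟩ := H.exists_flux_sub_eq hp haξ.le hξe le_rfl
  have hζI : ζ ∈ Ioo a e := ⟨haξ.trans hζ.1, hζ.2⟩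
  have hφe : 0 < φ e := hφ e ⟨by linarith, le_rfl⟩
  have h3 : φ₁ ξ * (x / 2) ≤ φ e := by
    have e1 := H.le_of_flux_pos hφ₁ (by linarith : a ≤ e - x / 2) (by linarith) le_rfl
    have e2 := hφ (e - x) ⟨hax, by linarith⟩
    have e3 : e - x / 2 - (e - x) = x / 2 := by ring
    rw [e3] at h1
    linarith
  have hpξ : 0 < p ξ := hpos ξ ⟨haξ, hξe.le⟩
  have h4 : p ξ * φ₁ ξ ≤ φ e * (2 * δ / x) := by
    have e1 : φ₁ ξ ≤ φ e * (2 / x) := by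
      rw [← mul_div_assoc, le_div_iff₀ hx]
      linarith
    calc p ξ * φ₁ ξ ≤ δ * (φ e * (2 / x)) :=
          mul_le_mul (hδ ξ ⟨hξ.1.le, hξ.2.le⟩) e1 (hφ₁ ξ ⟨haξ, hξe.le⟩).le
            (hpξ.le.trans (hδ ξ ⟨hξ.1.le, hξ.2.le⟩))
      _ = _ := by ring
  have h5 : p ζ * (k ζ * φ ζ) * (e - ξ) ≤ P * (K * φ e) * x := by
    have e1 := H.le_of_flux_pos hφ₁ hζI.1.le hζI.2.le le_rfl
    have e2 : p ζ ≤ P := hP ζ ⟨hξ.1.le.trans hζ.1.le, hζ.2.le⟩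
    have e3 := hpos ζ ⟨hζI.1, hζI.2.le⟩
    have e4 := hk ζ hζI
    have e5 := hkK ζ hζI
    have e6 := hφ ζ ⟨hζI.1, hζI.2.le⟩
    have e7 : e - ξ ≤ x := by linarith [hξ.1]
    have e8 : 0 ≤ e - ξ := by linarith
    gcongr
    · exact mul_nonneg (e3.le.trans e2) (mul_nonneg (e4.le.trans e5) hφe.le)
    · exact e3.le.trans e2
    · exact e4.le.trans e5
  linarith

/-- If the weight is large on `[e - x, e - x / 2]` and bounded below on `[e - x, e]`, then the
logarithmic derivative of `φ` at `e` is large. -/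
theorem le_flux_of_large_weight {w D κ : ℝ}
    (H : IsFluxSolution p (fun r => k r * φ r) a e φ φ₁) (hp : ContinuousOn p (Icc a e))
    (hpos : ∀ r ∈ Ioc a e, 0 < p r) (hκ : 0 < κ) (hk : ∀ r ∈ Ioo a e, κ ≤ k r)
    (hφ : ∀ r ∈ Ioc a e, 0 < φ r) (ha : φ₁ a = 0) (hx : 0 < x) (hax : a < e - x) (hw0 : 0 < w)
    (hD0 : 0 < D) (hw : ∀ r ∈ Icc (e - x) e, w ≤ p r)
    (hD : ∀ r ∈ Icc (e - x) (e - x / 2), D ≤ p r) :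
    φ e ≤ p e * φ₁ e * (x / w + 2 / (D * κ * x)) := by
  have hg : ∀ r ∈ Ioo a e, 0 < k r * φ r := fun r hr =>
    mul_pos (hκ.trans_le (hk r hr)) (hφ r ⟨hr.1, hr.2.le⟩)
  have hφ₁ := H.flux_pos hp hpos hg ha
  -- The far half alone produces flux at least `D κ φ(e - x) x / 2`, which bounds `φ(e - x)`. The
  -- increase from `e - x` to `e` is bounded by the final flux times `x / w`.
  obtain ⟨ξ, hξ, h1⟩ :=
    H.exists_flux_sub_eq hp hax.le (by linarith : e - x < e - x / 2) (by linarith)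
  obtain ⟨ζ, hζ, h2⟩ := H.exists_sub_eq hax.le (by linarith : e - x < e) le_rfl
  have haξ : a < ξ := hax.trans hξ.1
  have hξe : ξ < e := hξ.2.trans (by linarith)
  have haζ : a < ζ := hax.trans hζ.1
  have hφx : 0 < φ (e - x) := hφ _ ⟨hax, by linarith⟩
  have e3 : e - x / 2 - (e - x) = x / 2 := by ring
  have e4 : e - (e - x) = x := by ring
  rw [e3] at h1
  rw [e4] at h2
  have h3 : D * κ * φ (e - x) * (x / 2) ≤ p e * φ₁ e := by
    have f1 := H.flux_le_flux hp hpos hg (by linarith : a ≤ e - x / 2) (by linarith) le_rfl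
    have f2 : 0 < p (e - x) * φ₁ (e - x) :=
      mul_pos (hpos _ ⟨hax, by linarith⟩) (hφ₁ _ ⟨hax, by linarith⟩)
    have f3 : D * (κ * φ (e - x)) * (x / 2) ≤ p ξ * (k ξ * φ ξ) * (x / 2) := by
      have g1 := H.le_of_flux_pos hφ₁ hax.le hξ.1.le hξe.le
      have g2 := hD ξ ⟨hξ.1.le, hξ.2.le⟩
      have g3 := hk ξ ⟨haξ, hξe⟩
      have g4 := hpos ξ ⟨haξ, hξe.le⟩
      gcongr
      exact hκ.le.trans g3
    linarith
  have h4 : φ₁ ζ * x ≤ p e * φ₁ e * (x / w) := by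
    have f1 := H.flux_le_flux hp hpos hg haζ.le hζ.2.le le_rfl
    have f2 : w * φ₁ ζ ≤ p ζ * φ₁ ζ :=
      mul_le_mul_of_nonneg_right (hw ζ ⟨hζ.1.le, hζ.2.le⟩) (hφ₁ ζ ⟨haζ, hζ.2.le⟩).le
    rw [← mul_div_assoc, le_div_iff₀ hw0]
    nlinarith
  have h5 : φ (e - x) ≤ p e * φ₁ e * (2 / (D * κ * x)) := by
    rw [← mul_div_assoc, le_div_iff₀ (by positivity)]
    linarith
  linarith

end Barrier

section Side

variable {w m k φ φ₁ : ℝ → ℝ} {x s w₀ : ℝ}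

/-- The small-weight barrier at the scale `s = 1 / x ^ 4`: the weight is at most `exp 2` on the
whole layer and at most `4 x ^ 2` on its far half, so both error terms are of order `x`. -/
theorem deriv_le_of_negative_peak {K : ℝ}
    (H : IsFluxSolution (fun r => w r * Real.exp (2 * s * m r)) (fun r => k r * φ r)
      0 (1 / 3) φ φ₁)
    (hw : Continuous w) (hm : Continuous m) (hwpos : ∀ r ∈ Ioc (0 : ℝ) (1 / 3), 0 < w r)
    (hw₀ : ∀ r ∈ Icc (1 / 6 : ℝ) (1 / 3), w₀ ≤ w r ∧ w r ≤ 1)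
    (hk : ∀ r ∈ Ioo (0 : ℝ) (1 / 3), 0 < k r) (hkK : ∀ r ∈ Ioo (0 : ℝ) (1 / 3), k r ≤ K)
    (hφ : ∀ r ∈ Ioc (0 : ℝ) (1 / 3), 0 < φ r) (ha : φ₁ 0 = 0)
    (hx : 0 < x) (hx6 : x < 1 / 6) (hs : s * x ^ 4 = 1) (hm0 : m (1 / 3) = 0)
    (hpeak : ∀ r ∈ Icc (1 / 3 - x) (1 / 3 - x / 2), m r ≤ -(x ^ 2 / 8))
    (hsmall : ∀ r ∈ Icc (1 / 3 - x) (1 / 3), m r ≤ x ^ 4) :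
    w₀ * φ₁ (1 / 3) ≤ φ (1 / 3) * ((8 + Real.exp 2 * K) * x) := by
  have hs0 : 0 < s := by
    by_contra! h
    have : s * x ^ 4 ≤ 0 := mul_nonpos_of_nonpos_of_nonneg h (by positivity)
    linarith
  have hcont : Continuous fun r => w r * Real.exp (2 * s * m r) := by fun_prop
  have hpos : ∀ r ∈ Ioc (0 : ℝ) (1 / 3), 0 < w r * Real.exp (2 * s * m r) := fun r hr =>
    mul_pos (hwpos r hr) (Real.exp_pos _)
  have hle : ∀ r ∈ Icc (1 / 3 - x) (1 / 3), w r * Real.exp (2 * s * m r) ≤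
      Real.exp (2 * s * m r) := fun r hr =>
    mul_le_of_le_one_left (Real.exp_pos _).le (hw₀ r ⟨by linarith [hr.1], hr.2⟩).2
  have h1 := H.flux_le_of_small_weight (x := x) (P := Real.exp 2) (δ := 4 * x ^ 2)
    hcont.continuousOn hpos hk hkK hφ ha hx (by linarith) (fun r hr => ?_) (fun r hr => ?_)
  · have hk13 : 0 < φ₁ (1 / 3) := H.flux_pos hcont.continuousOn hpos
      (fun r hr => mul_pos (hk r hr) (hφ r ⟨hr.1, hr.2.le⟩)) ha _ ⟨by norm_num, le_rfl⟩
    have h2 : w₀ * φ₁ (1 / 3) ≤ w (1 / 3) * φ₁ (1 / 3) :=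
      mul_le_mul_of_nonneg_right (hw₀ _ ⟨by norm_num, le_rfl⟩).1 hk13.le
    have h3 : 2 * (4 * x ^ 2) / x + Real.exp 2 * K * x = (8 + Real.exp 2 * K) * x := by
      field_simp
      ring
    simp only [hm0, mul_zero, Real.exp_zero, mul_one] at h1
    rw [h3] at h1
    linarith
  · refine (hle r hr).trans (Real.exp_le_exp.2 ?_)
    have := mul_le_mul_of_nonneg_left (hsmall r hr) hs0.le
    linarith
  · refine (hle r ⟨hr.1, hr.2.trans (by linarith)⟩).trans ?_
    have h2 : s * m r ≤ s * -(x ^ 2 / 8) := mul_le_mul_of_nonneg_left (hpeak r hr) hs0.le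
    have h3 : s * (x ^ 2 / 8) * (8 * x ^ 2) = 1 := by linear_combination hs
    -- Here `2 s x² / 8 = 1 / (4 x²)`, so the linear bound `1 + y ≤ exp y` already suffices.
    have h4 : 1 ≤ Real.exp (2 * (s * (x ^ 2 / 8))) * (4 * x ^ 2) := by
      have := Real.add_one_le_exp (2 * (s * (x ^ 2 / 8)))
      nlinarith [sq_nonneg x]
    have h5 : Real.exp (2 * s * m r) ≤ Real.exp (-(2 * (s * (x ^ 2 / 8)))) :=
      Real.exp_le_exp.2 (by linarith)
    refine h5.trans ?_
    rw [Real.exp_neg, inv_le_iff_one_le_mul₀ (Real.exp_pos _)]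
    linarith

/-- The large-weight barrier at the scale `s = 1 / x ^ 4`: the weight is at least `w₀ exp (-2)` on
the layer and at least `w₀ / (4 x ^ 2)` on its far half, so both terms are again of order `x`. -/
theorem le_deriv_of_positive_peak {κ : ℝ}
    (H : IsFluxSolution (fun r => w r * Real.exp (2 * s * m r)) (fun r => k r * φ r)
      0 (1 / 3) φ φ₁)
    (hw : Continuous w) (hm : Continuous m) (hwpos : ∀ r ∈ Ioc (0 : ℝ) (1 / 3), 0 < w r)
    (hw₀pos : 0 < w₀) (hw₀ : ∀ r ∈ Icc (1 / 6 : ℝ) (1 / 3), w₀ ≤ w r ∧ w r ≤ 1)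
    (hκ : 0 < κ) (hk : ∀ r ∈ Ioo (0 : ℝ) (1 / 3), κ ≤ k r)
    (hφ : ∀ r ∈ Ioc (0 : ℝ) (1 / 3), 0 < φ r) (ha : φ₁ 0 = 0)
    (hx : 0 < x) (hx6 : x < 1 / 6) (hs : s * x ^ 4 = 1) (hm0 : m (1 / 3) = 0)
    (hpeak : ∀ r ∈ Icc (1 / 3 - x) (1 / 3 - x / 2), x ^ 2 / 8 ≤ m r)
    (hsmall : ∀ r ∈ Icc (1 / 3 - x) (1 / 3), -x ^ 4 ≤ m r) :
    φ (1 / 3) ≤ φ₁ (1 / 3) * ((Real.exp 2 / w₀ + 8 / (w₀ * κ)) * x) := by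
  have hs0 : 0 < s := by
    by_contra! h
    have : s * x ^ 4 ≤ 0 := mul_nonpos_of_nonpos_of_nonneg h (by positivity)
    linarith
  have hcont : Continuous fun r => w r * Real.exp (2 * s * m r) := by fun_prop
  have hpos : ∀ r ∈ Ioc (0 : ℝ) (1 / 3), 0 < w r * Real.exp (2 * s * m r) := fun r hr =>
    mul_pos (hwpos r hr) (Real.exp_pos _)
  have hge : ∀ r ∈ Icc (1 / 3 - x) (1 / 3), w₀ * Real.exp (2 * s * m r) ≤
      w r * Real.exp (2 * s * m r) := fun r hr =>
    mul_le_mul_of_nonneg_right (hw₀ r ⟨by linarith [hr.1], hr.2⟩).1 (Real.exp_pos _).le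
  have h1 := H.le_flux_of_large_weight (x := x) (w := w₀ * Real.exp (-2))
    (D := w₀ * (1 / (4 * x ^ 2)))
    hcont.continuousOn hpos hκ hk hφ ha hx (by linarith) (by positivity) (by positivity)
    (fun r hr => ?_) (fun r hr => ?_)
  · have hk13 : 0 < φ₁ (1 / 3) := H.flux_pos hcont.continuousOn hpos
      (fun r hr => mul_pos (hκ.trans_le (hk r hr)) (hφ r ⟨hr.1, hr.2.le⟩)) ha _
      ⟨by norm_num, le_rfl⟩
    have h3 : x / (w₀ * Real.exp (-2)) + 2 / (w₀ * (1 / (4 * x ^ 2)) * κ * x) =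
        (Real.exp 2 / w₀ + 8 / (w₀ * κ)) * x := by
      rw [Real.exp_neg]
      field_simp
      ring
    simp only [hm0, mul_zero, Real.exp_zero, mul_one] at h1
    rw [h3] at h1
    refine h1.trans (mul_le_mul_of_nonneg_right ?_ (by positivity))
    exact mul_le_of_le_one_left hk13.le (hw₀ _ ⟨by norm_num, le_rfl⟩).2
  · refine le_trans ?_ (hge r hr)
    refine mul_le_mul_of_nonneg_left (Real.exp_le_exp.2 ?_) hw₀pos.le
    have := mul_le_mul_of_nonneg_left (hsmall r hr) hs0.le
    linarith
  · refine le_trans ?_ (hge r ⟨hr.1, hr.2.trans (by linarith)⟩)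
    refine mul_le_mul_of_nonneg_left ?_ hw₀pos.le
    have h2 : s * (x ^ 2 / 8) ≤ s * m r := mul_le_mul_of_nonneg_left (hpeak r hr) hs0.le
    have h3 : s * (x ^ 2 / 8) * (8 * x ^ 2) = 1 := by linear_combination hs
    have h4 : 1 / (4 * x ^ 2) = 2 * (s * (x ^ 2 / 8)) := by
      field_simp
      linear_combination (-8) * hs
    rw [h4]
    have := Real.add_one_le_exp (2 * s * m r)
    linarith

end Side

/-! ### Stability of the middle eigenvalues under approximate boundary conditions -/

section Middle

variable {p c φ φ₁ ψ ψ₁ : ℝ → ℝ} {a b μ ν : ℝ}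

/-- A positive solution has an eigenvalue parameter close to that of a Dirichlet eigenfunction `ψ`
if it is small compared to its derivative at the endpoints. -/
theorem exists_lower_bound (hab : a < b) (hp : ContinuousOn p (Icc a b))
    (hpos : ∀ r ∈ Ioo a b, 0 < p r) (hpa : 0 ≤ p a) (hpb : 0 ≤ p b) (hc : Continuous c)
    (Hψ : IsFluxSolution p (fun r => (c r - ν) * ψ r) a b ψ ψ₁)
    (hψ : ∀ r ∈ Ioo a b, 0 < ψ r) (hψa : ψ a = 0) (hψb : ψ b = 0)
    (hca : ν < c a) (hcb : ν < c b) {ε : ℝ} (hε : 0 < ε) :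
    ∃ η > 0, ∀ (μ : ℝ) (φ φ₁ : ℝ → ℝ), IsFluxSolution p (fun r => (c r - μ) * φ r) a b φ φ₁ →
      (∀ r ∈ Icc a b, 0 < φ r) → φ a ≤ η * φ₁ a → φ b ≤ η * (-φ₁ b) → ν - ε ≤ μ := by
  obtain ⟨K, hK⟩ := isCompact_Icc.exists_bound_of_continuousOn
    ((hc.sub continuous_const).continuousOn (s := Icc a b) (f := fun r => c r - ν))
  -- Because `c > ν` at both endpoints, the set where `c ≤ ν` is compact inside the open interval,
  -- and `ψ` is bounded below on it.
  obtain ⟨δ, hδ, hδψ⟩ : ∃ δ > 0, ∀ r ∈ Icc a b, c r ≤ ν → δ ≤ ψ r := by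
    have hcomp : IsCompact (Icc a b ∩ c ⁻¹' Iic ν) :=
      isCompact_Icc.inter_right (isClosed_Iic.preimage hc)
    rcases (Icc a b ∩ c ⁻¹' Iic ν).eq_empty_or_nonempty with he | hne
    · exact ⟨1, one_pos, fun r hr h => absurd (he ▸ ⟨hr, h⟩ : r ∈ (∅ : Set ℝ)) (by simp)⟩
    · obtain ⟨y, hy, hmin⟩ := hcomp.exists_isMinOn hne (Hψ.continuousOn.mono inter_subset_left)
      refine ⟨ψ y, hψ y ⟨lt_of_le_of_ne hy.1.1 fun h => ?_, lt_of_le_of_ne hy.1.2 fun h => ?_⟩,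
        fun r hr h => hmin ⟨hr, h⟩⟩
      · exact absurd hy.2 (by rw [← h]; exact not_le.2 hca)
      · exact absurd hy.2 (by rw [h]; exact not_le.2 hcb)
  have hK0 : 0 ≤ K := (norm_nonneg _).trans (hK a (left_mem_Icc.2 hab.le))
  set τ := ε * δ / (K + 1) with hτ
  have hτ0 : 0 < τ := by positivity
  have hτK : τ * K < ε * δ := by
    rw [hτ, div_mul_eq_mul_div, div_lt_iff₀ (by positivity)]
    have : 0 < ε * δ := by positivity
    linarith
  set η := τ / (|ψ₁ a| + |ψ₁ b| + 1) with hη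
  have hη0 : 0 < η := by positivity
  have hηe : η * (|ψ₁ a| + |ψ₁ b| + 1) = τ := by
    rw [hη]
    field_simp
  have hηa : η * |ψ₁ a| ≤ τ := by
    nlinarith [mul_nonneg hη0.le (abs_nonneg (ψ₁ b)), mul_nonneg hη0.le (abs_nonneg (ψ₁ a))]
  have hηb : η * |ψ₁ b| ≤ τ := by
    nlinarith [mul_nonneg hη0.le (abs_nonneg (ψ₁ b)), mul_nonneg hη0.le (abs_nonneg (ψ₁ a))]
  refine ⟨η, hη0, fun μ φ φ₁ H hφ h1 h2 => ?_⟩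
  by_contra! hlt
  -- Comparison with `ψ + τ`. If `μ < ν - ε`, its Wronskian with `φ` increases strictly: where `c >
  -- ν` the shift helps, and where `c ≤ ν` the choice of `τ` makes it harmless. The boundary
  -- hypotheses on `φ` give the opposite order of the endpoint values.
  have Hu : IsFluxSolution p (fun r => (c r - ν) * ψ r) a b (fun r => ψ r + τ) ψ₁ :=
    ⟨Hψ.continuousOn.add continuousOn_const, Hψ.continuousOn_deriv,
      fun r hr => (Hψ.hasDerivAt r hr).add_const τ, Hψ.hasDerivAt_flux⟩
  have hW := H.wronskian_lt Hu hp hab fun r hr => by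
    have hr' := Ioo_subset_Icc_self hr
    have h3 : 0 < (ν - μ) * (ψ r + τ) + τ * (c r - ν) := by
      have hψr := hψ r hr
      rcases le_or_gt (c r) ν with h | h
      · have f1 := hδψ r hr' h
        have f2 := hK r hr'
        rw [Real.norm_eq_abs] at f2
        have f3 := (abs_le.1 f2).1
        have f4 : ε * δ ≤ (ν - μ) * (ψ r + τ) :=
          mul_le_mul (by linarith) (by linarith) hδ.le (by linarith)
        have f5 : τ * -K ≤ τ * (c r - ν) := mul_le_mul_of_nonneg_left f3 hτ0.le
        linarith
      · exact add_pos (mul_pos (by linarith) (by linarith)) (mul_pos hτ0 (by linarith))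
    have := mul_pos (hpos r hr) (mul_pos (hφ r hr') h3)
    linarith
  simp only [hψa, hψb, zero_add] at hW
  have hφa := hφ a (left_mem_Icc.2 hab.le)
  have hφb := hφ b (right_mem_Icc.2 hab.le)
  have hda : 0 ≤ φ₁ a := by
    by_contra! h
    nlinarith
  have hdb : 0 ≤ -φ₁ b := by
    by_contra! h
    nlinarith
  have hWa : 0 ≤ φ₁ a * τ - φ a * ψ₁ a := by
    have f1 : φ a * ψ₁ a ≤ η * φ₁ a * |ψ₁ a| :=
      (mul_le_mul_of_nonneg_left (le_abs_self _) hφa.le).trans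
        (mul_le_mul_of_nonneg_right h1 (abs_nonneg _))
    have f2 := mul_le_mul_of_nonneg_left hηa hda
    linarith
  have hWb : φ₁ b * τ - φ b * ψ₁ b ≤ 0 := by
    have f1 : φ b * -ψ₁ b ≤ η * (-φ₁ b) * |ψ₁ b| :=
      (mul_le_mul_of_nonneg_left (neg_le_abs _) hφb.le).trans
        (mul_le_mul_of_nonneg_right h2 (abs_nonneg _))
    have f2 := mul_le_mul_of_nonneg_left hηb hdb
    linarith
  linarith [mul_nonneg hpa hWa, mul_nonneg hpb (neg_nonneg.2 hWb)]

/-- A positive solution has an eigenvalue parameter close to that of a Neumann eigenfunction `ψ`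
if its logarithmic derivative at the endpoints is small. -/
theorem exists_upper_bound {ρ : ℝ → ℝ} {R Λ : ℝ} (hab : a < b) (hp : ContinuousOn p (Icc a b))
    (hpos : ∀ r ∈ Icc a b, 0 < p r) (hp' : ∀ r ∈ Ioo a b, HasDerivAt p (ρ r * p r) r)
    (hρ : ∀ r ∈ Ioo a b, |ρ r| ≤ R) (hc : Continuous c)
    (Hψ : IsFluxSolution p (fun r => (c r - ν) * ψ r) a b ψ ψ₁)
    (hψ : ∀ r ∈ Icc a b, 0 < ψ r) (hψa : ψ₁ a = 0) (hψb : ψ₁ b = 0) {ε : ℝ} (hε : 0 < ε) :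
    ∃ η > 0, ∀ (μ : ℝ) (φ φ₁ : ℝ → ℝ), μ ≤ Λ →
      IsFluxSolution p (fun r => (c r - μ) * φ r) a b φ φ₁ →
      (∀ r ∈ Icc a b, 0 < φ r) → φ₁ a ≤ η * φ a → -φ₁ b ≤ η * φ b → μ ≤ ν + ε := by
  obtain ⟨K, hK⟩ := isCompact_Icc.exists_bound_of_continuousOn (hc.continuousOn (s := Icc a b))
  obtain ⟨y, hy, hmin⟩ := isCompact_Icc.exists_isMinOn (nonempty_Icc.2 hab.le) Hψ.continuousOn
  have hδ : 0 < ψ y := hψ y hy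
  have hK0 : 0 ≤ K := (norm_nonneg _).trans (hK a (left_mem_Icc.2 hab.le))
  have hR0 : 0 ≤ R := by
    have hm : (a + b) / 2 ∈ Ioo a b := ⟨by linarith, by linarith⟩
    exact (abs_nonneg _).trans (hρ _ hm)
  set ℓ := b - a with hℓ
  have hℓ0 : 0 < ℓ := sub_pos.2 hab
  -- Bounds the coefficient of `τ` that the perturbation below contributes to the Wronskian
  -- derivative; the a priori bound `Λ` on `μ` keeps it uniform.
  set C := (K + |ν| + |Λ|) * (ℓ * ℓ) + 2 + R * ℓ with hC
  have hC0 : 0 < C := by positivity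
  set τ := ε * ψ y / (C + 1) with hτ
  have hτ0 : 0 < τ := by positivity
  have hτC : τ * C < ε * ψ y := by
    rw [hτ, div_mul_eq_mul_div, div_lt_iff₀ (by positivity)]
    have : 0 < ε * ψ y := by positivity
    linarith
  have hψaI := hψ a (left_mem_Icc.2 hab.le)
  have hψbI := hψ b (right_mem_Icc.2 hab.le)
  set η := τ * ℓ / (ψ a + ψ b) with hη
  have hη0 : 0 < η := by positivity
  have hηe : η * (ψ a + ψ b) = τ * ℓ := by
    rw [hη]
    field_simp
  refine ⟨η, hη0, fun μ φ φ₁ hμΛ H hφ h1 h2 => ?_⟩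
  by_contra! hlt
  -- The bump `τ (r - a) (b - r)` vanishes at the endpoints but has inward slope `τ ℓ` there, which
  -- absorbs the small logarithmic derivatives allowed for `φ`.
  have Hu : IsFluxSolution p
      (fun r => (c r - ν) * ψ r + τ * (ρ r * (a + b - 2 * r) - 2)) a b
      (fun r => ψ r + τ * ((r - a) * (b - r))) (fun r => ψ₁ r + τ * (a + b - 2 * r)) := by
    refine ⟨Hψ.continuousOn.add (by fun_prop), Hψ.continuousOn_deriv.add (by fun_prop),
      fun r hr => ?_, fun r hr => ?_⟩
    · have f1 : HasDerivAt (fun r : ℝ => (r - a) * (b - r)) (1 * (b - r) + (r - a) * -1) r :=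
        ((hasDerivAt_id r).sub_const a).mul ((hasDerivAt_id r).const_sub b)
      exact ((Hψ.hasDerivAt r hr).add (f1.const_mul τ)).congr_deriv (by ring)
    · have f1 : HasDerivAt (fun r : ℝ => τ * (a + b - 2 * r)) (τ * -(2 * 1)) r :=
        (((hasDerivAt_id r).const_mul 2).const_sub (a + b)).const_mul τ
      have f2 := (Hψ.hasDerivAt_flux r hr).add ((hp' r hr).mul f1)
      refine HasDerivAt.congr_deriv (f := fun t => p t * (ψ₁ t + τ * (a + b - 2 * t))) ?_
        (by ring : p r * ((c r - ν) * ψ r) + (ρ r * p r * (τ * (a + b - 2 * r)) +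
          p r * (τ * -(2 * 1))) = _)
      refine f2.congr_of_eventuallyEq (.of_forall fun t => ?_)
      simp only [Pi.add_apply, Pi.mul_apply]
      ring
  -- Now `μ > ν`, so the Wronskian has the opposite monotonicity; replacing `φ` by `-φ` restores an
  -- increasing one.
  have hW := H.neg.wronskian_lt Hu hp hab fun r hr => by
    have hr' := Ioo_subset_Icc_self hr
    have g1 : 0 ≤ (r - a) * (b - r) := mul_nonneg (by linarith [hr.1]) (by linarith [hr.2])
    have g2 : (r - a) * (b - r) ≤ ℓ * ℓ :=
      mul_le_mul (by linarith [hr.2]) (by linarith [hr.1]) (by linarith [hr.2]) hℓ0.le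
    have g3 : |c r - μ| ≤ K + |ν| + |Λ| := by
      have f2 := hK r hr'
      rw [Real.norm_eq_abs, abs_le] at f2
      rw [abs_le]
      constructor
      · linarith [le_abs_self Λ, abs_nonneg ν]
      · linarith [neg_abs_le ν, abs_nonneg Λ]
    have g4 : (c r - μ) * ((r - a) * (b - r)) ≤ (K + |ν| + |Λ|) * (ℓ * ℓ) :=
      (mul_le_mul_of_nonneg_right ((le_abs_self _).trans g3) g1).trans
        (mul_le_mul_of_nonneg_left g2 (by positivity))
    have g5 : -(ρ r * (a + b - 2 * r)) ≤ R * ℓ := by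
      have : |ρ r * (a + b - 2 * r)| ≤ R * ℓ := by
        rw [abs_mul]
        refine mul_le_mul (hρ r hr) ?_ (abs_nonneg _) hR0
        rw [abs_le]
        constructor <;> linarith [hr.1, hr.2]
      linarith [neg_le_abs (ρ r * (a + b - 2 * r))]
    have g6 : τ * ((c r - μ) * ((r - a) * (b - r)) - (ρ r * (a + b - 2 * r) - 2)) ≤ τ * C :=
      mul_le_mul_of_nonneg_left (by linarith) hτ0.le
    have g7 : ε * ψ y ≤ (μ - ν) * ψ r :=
      mul_le_mul (by linarith) (hmin hr') hδ.le (by linarith)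
    have g8 : 0 < (μ - ν) * ψ r -
        τ * ((c r - μ) * ((r - a) * (b - r)) - (ρ r * (a + b - 2 * r) - 2)) := by linarith
    have := mul_pos (hpos r hr') (mul_pos (hφ r hr') g8)
    linarith
  simp only [hψa, hψb, sub_self, zero_mul, mul_zero, add_zero, zero_add] at hW
  have hφa := hφ a (left_mem_Icc.2 hab.le)
  have hφb := hφ b (right_mem_Icc.2 hab.le)
  have hWa : 0 ≤ -φ₁ a * ψ a - -φ a * (τ * (a + b - 2 * a)) := by
    have f1 := mul_le_mul_of_nonneg_right h1 hψaI.le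
    have f2 : φ a * (η * ψ a) ≤ φ a * (τ * ℓ) :=
      mul_le_mul_of_nonneg_left (by nlinarith [mul_pos hη0 hψbI]) hφa.le
    have f3 : a + b - 2 * a = ℓ := by ring
    rw [f3]
    linarith
  have hWb : -φ₁ b * ψ b - -φ b * (τ * (a + b - 2 * b)) ≤ 0 := by
    have f1 := mul_le_mul_of_nonneg_right h2 hψbI.le
    have f2 : φ b * (η * ψ b) ≤ φ b * (τ * ℓ) :=
      mul_le_mul_of_nonneg_left (by nlinarith [mul_pos hη0 hψaI]) hφb.le
    have f3 : a + b - 2 * b = -ℓ := by ring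
    rw [f3]
    linarith
  linarith [mul_nonneg (hpos a (left_mem_Icc.2 hab.le)).le hWa,
    mul_nonneg (hpos b (right_mem_Icc.2 hab.le)).le (neg_nonneg.2 hWb)]

end Middle

end IsFluxSolution

/-! ### The drift potential and its scales -/

/-- The infinitely oscillating drift potential. -/
noncomputable def oscDrift (r : ℝ) : ℝ := osc (1 / 3 - r) + osc (r - 2 / 3)

theorem oscDrift_eq_zero {r : ℝ} (hr : r ∈ Icc (1 / 3 : ℝ) (2 / 3)) : oscDrift r = 0 := by
  rw [oscDrift, osc_of_nonpos (by linarith [hr.1]), osc_of_nonpos (by linarith [hr.2]), add_zero]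

theorem oscDrift_one_sub (r : ℝ) : oscDrift (1 - r) = oscDrift r := by
  unfold oscDrift
  rw [add_comm]
  congr 2 <;> ring

theorem oscDrift_of_le {r : ℝ} (hr : r ≤ 1 / 3) : oscDrift r = osc (1 / 3 - r) := by
  rw [oscDrift, osc_of_nonpos (by linarith : r - 2 / 3 ≤ 0), add_zero]

theorem hasDerivAt_oscDrift (r : ℝ) :
    HasDerivAt oscDrift (-oscDeriv (1 / 3 - r) + oscDeriv (r - 2 / 3)) r := by
  have h1 := (hasDerivAt_osc (1 / 3 - r)).comp r ((hasDerivAt_id r).const_sub (1 / 3))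
  have h2 := (hasDerivAt_osc (r - 2 / 3)).comp r ((hasDerivAt_id r).sub_const (2 / 3))
  exact (h1.add h2).congr_deriv (by simp)

theorem continuous_deriv_oscDrift : Continuous (deriv oscDrift) := by
  rw [funext fun r => (hasDerivAt_oscDrift r).deriv]
  have := continuous_oscDeriv
  fun_prop

theorem contDiff_oscDrift : ContDiff ℝ 1 oscDrift :=
  contDiff_one_iff_deriv.2
    ⟨fun r => (hasDerivAt_oscDrift r).differentiableAt, continuous_deriv_oscDrift⟩

theorem continuous_oscDrift : Continuous oscDrift := contDiff_oscDrift.continuous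

theorem exists_oscDrift_positive_peak {ε : ℝ} (hε : 0 < ε) :
    ∃ x, 0 < x ∧ x < ε ∧
      (∀ r ∈ Icc (1 / 3 - x) (1 / 3 - x / 2), x ^ 2 / 8 ≤ oscDrift r) ∧
      (∀ r ∈ Icc (1 / 3 - x) (1 / 3), -x ^ 4 ≤ oscDrift r) := by
  obtain ⟨x, hx, hxε, h1, h2⟩ := exists_osc_peak 0 hε
  simp only [add_zero] at h1 h2
  refine ⟨x, hx, hxε, fun r hr => ?_, fun r hr => ?_⟩
  · rw [oscDrift_of_le (by linarith [hr.2]), osc_of_pos (by linarith [hr.2])]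
    exact h1 _ ⟨by linarith [hr.2], by linarith [hr.1]⟩
  · rw [oscDrift_of_le hr.2]
    rcases eq_or_lt_of_le hr.2 with rfl | h
    · rw [osc_of_nonpos (by simp)]
      linarith [pow_pos hx 4]
    · rw [osc_of_pos (by linarith)]
      exact h2 _ ⟨by linarith, by linarith [hr.1]⟩

theorem exists_oscDrift_negative_peak {ε : ℝ} (hε : 0 < ε) :
    ∃ x, 0 < x ∧ x < ε ∧
      (∀ r ∈ Icc (1 / 3 - x) (1 / 3 - x / 2), oscDrift r ≤ -(x ^ 2 / 8)) ∧
      (∀ r ∈ Icc (1 / 3 - x) (1 / 3), oscDrift r ≤ x ^ 4) := by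
  -- The phase shift `π` turns troughs of the oscillation into peaks.
  obtain ⟨x, hx, hxε, h1, h2⟩ := exists_osc_peak Real.pi hε
  simp only [Real.sin_add_pi, mul_neg] at h1 h2
  refine ⟨x, hx, hxε, fun r hr => ?_, fun r hr => ?_⟩
  · rw [oscDrift_of_le (by linarith [hr.2]), osc_of_pos (by linarith [hr.2])]
    linarith [h1 (1 / 3 - r) ⟨by linarith [hr.2], by linarith [hr.1]⟩]
  · rw [oscDrift_of_le hr.2]
    rcases eq_or_lt_of_le hr.2 with rfl | h
    · rw [osc_of_nonpos (by simp)]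
      exact (pow_pos hx 4).le
    · rw [osc_of_pos (by linarith)]
      linarith [h2 (1 / 3 - r) ⟨by linarith, by linarith [hr.1]⟩]

theorem frequently_left_of_peak {P : ℝ → Prop} {a : ℝ}
    (h : ∀ ε > 0, ∃ x, 0 < x ∧ x < ε ∧ P (a - x)) : ∃ᶠ r in 𝓝[<] a, P r := by
  rw [frequently_iff]
  intro U hU
  obtain ⟨l, hl, hsub⟩ := (mem_nhdsLT_iff_exists_Ioo_subset).1 hU
  obtain ⟨x, hx, hxl, hP⟩ := h (a - l) (sub_pos.2 hl)
  exact ⟨a - x, hsub ⟨by linarith, by linarith⟩, hP⟩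

theorem frequently_right_of_peak {P : ℝ → Prop} {a : ℝ}
    (h : ∀ ε > 0, ∃ x, 0 < x ∧ x < ε ∧ P (a + x)) : ∃ᶠ r in 𝓝[>] a, P r := by
  rw [frequently_iff]
  intro U hU
  obtain ⟨l, hl, hsub⟩ := (mem_nhdsGT_iff_exists_Ioo_subset).1 hU
  obtain ⟨x, hx, hxl, hP⟩ := h (l - a) (sub_pos.2 hl)
  exact ⟨a + x, hsub ⟨by linarith, by linarith⟩, hP⟩

theorem oscillatesInfinitely_left : OscillatesInfinitely oscDrift (𝓝[<] (1 / 3)) := by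
  constructor
  · refine frequently_left_of_peak fun ε hε => ?_
    obtain ⟨x, hx, hxε, h1, -⟩ := exists_oscDrift_positive_peak hε
    exact ⟨x, hx, hxε, (by positivity : 0 < x ^ 2 / 8).trans_le
      (h1 _ ⟨le_rfl, by linarith⟩)⟩
  · refine frequently_left_of_peak fun ε hε => ?_
    obtain ⟨x, hx, hxε, h1, -⟩ := exists_oscDrift_negative_peak hε
    exact ⟨x, hx, hxε, (h1 _ ⟨le_rfl, by linarith⟩).trans_lt
      (neg_lt_zero.2 (by positivity))⟩

theorem oscillatesInfinitely_right : OscillatesInfinitely oscDrift (𝓝[>] (2 / 3)) := by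
  have key : ∀ x, oscDrift (2 / 3 + x) = oscDrift (1 / 3 - x) := fun x => by
    rw [← oscDrift_one_sub]
    congr 1
    ring
  constructor
  · refine frequently_right_of_peak fun ε hε => ?_
    obtain ⟨x, hx, hxε, h1, -⟩ := exists_oscDrift_positive_peak hε
    refine ⟨x, hx, hxε, ?_⟩
    rw [key]
    exact (by positivity : 0 < x ^ 2 / 8).trans_le (h1 _ ⟨le_rfl, by linarith⟩)
  · refine frequently_right_of_peak fun ε hε => ?_
    obtain ⟨x, hx, hxε, h1, -⟩ := exists_oscDrift_negative_peak hε
    refine ⟨x, hx, hxε, ?_⟩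
    rw [key]
    exact (h1 _ ⟨le_rfl, by linarith⟩).trans_lt (neg_lt_zero.2 (by positivity))

/-- Admissible scales below `1 / (n + 1)` give parameters `1 / x ^ 4 ≥ n`, so estimates valid only
at good scales still yield a sequence tending to infinity. -/
theorem exists_seq_tendsto_of_scales {P : ℝ → Prop} {f : ℝ → ℝ} {L : ℝ}
    (hP : ∀ ε > 0, ∃ x, 0 < x ∧ x < ε ∧ P x)
    (hf : ∀ ε > 0, ∃ δ > 0, ∀ x, 0 < x → x < δ → P x → |f (1 / x ^ 4) - L| ≤ ε) :
    ∃ s : ℕ → ℝ, Tendsto s atTop atTop ∧ Tendsto (fun n => f (s n)) atTop (𝓝 L) := by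
  choose X hX0 hX1 hXP using fun n : ℕ => hP (1 / ((n : ℝ) + 1)) (by positivity)
  refine ⟨fun n => 1 / X n ^ 4, ?_, ?_⟩
  · refine tendsto_atTop_mono (fun n => ?_) tendsto_natCast_atTop_atTop
    have h0 := hX0 n
    have h1 : X n * ((n : ℝ) + 1) < 1 := (lt_div_iff₀ (by positivity)).1 (hX1 n)
    have hn : (0 : ℝ) ≤ n := Nat.cast_nonneg n
    have h2 : X n ≤ 1 := by nlinarith
    rw [le_div_iff₀ (by positivity)]
    have h3 : X n ^ 4 ≤ X n := by
      simpa using pow_le_pow_of_le_one h0.le h2 (show 1 ≤ 4 by norm_num)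
    nlinarith
  · rw [Metric.tendsto_atTop]
    intro ε hε
    obtain ⟨δ, hδ, h⟩ := hf (ε / 2) (by positivity)
    obtain ⟨N, hN⟩ := exists_nat_one_div_lt hδ
    refine ⟨N, fun n hn => ?_⟩
    have h1 : X n < δ := (hX1 n).trans ((one_div_le_one_div_of_le (by positivity)
      (by exact_mod_cast Nat.succ_le_succ hn)).trans_lt hN)
    rw [Real.dist_eq]
    linarith [h (X n) (hX0 n) h1 (hXP n)]

/-! ### The radial problem on the ball and on the middle interval -/

section Radial

variable {d : ℕ} {c : ℝ → ℝ}

theorem continuous_ballWeight (s : ℝ) :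
    Continuous fun r : ℝ => r ^ (d - 1) * Real.exp (2 * s * oscDrift r) := by
  have := continuous_oscDrift
  fun_prop

theorem hasDerivAt_ballWeight (hd : 1 ≤ d) (s : ℝ) {r : ℝ} (hr : 0 < r) :
    HasDerivAt (fun r : ℝ => r ^ (d - 1) * Real.exp (2 * s * oscDrift r))
      ((((d : ℝ) - 1) / r + 2 * s * deriv oscDrift r) *
        (r ^ (d - 1) * Real.exp (2 * s * oscDrift r))) r := by
  refine hasDerivAt_radialWeight hd hr ?_
  rw [(hasDerivAt_oscDrift r).deriv]
  exact (hasDerivAt_oscDrift r).const_mul (2 * s)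

theorem hasDerivAt_middleWeight (hd : 1 ≤ d) {r : ℝ} (hr : 0 < r) :
    HasDerivAt (fun r : ℝ => r ^ (d - 1)) ((((d : ℝ) - 1) / r + 0) * r ^ (d - 1)) r := by
  simpa using hasDerivAt_radialWeight hd hr (hasDerivAt_const r (0 : ℝ))

theorem exists_ballEigenvalue (hd : 1 ≤ d) (hc : Continuous c) (s : ℝ) :
    ∃ lam : ℝ, ∀ μ, IsBallEigenvalue d c oscDrift s μ ↔ μ = lam := by
  have hcont := continuous_ballWeight (d := d) s
  have hpos : ∀ r ∈ Ioc (0 : ℝ) 1, 0 < r ^ (d - 1) * Real.exp (2 * s * oscDrift r) :=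
    fun r hr => mul_pos (pow_pos hr.1 _) (Real.exp_pos _)
  have hw : ∀ r ∈ Ioo (0 : ℝ) 1, _ := fun r hr => hasDerivAt_ballWeight hd s hr.1
  obtain ⟨K, hK⟩ := isCompact_Icc.exists_bound_of_continuousOn
    ((continuous_const.mul continuous_oscDrift).continuousOn (s := Icc (0 : ℝ) 1)
      (f := fun r => 2 * s * oscDrift r))
  -- The power is monotone, and the exponential factor varies by at most `exp (2 K)`.
  have hM : ∀ r ∈ Icc (0 : ℝ) 1, ∀ t ∈ Icc (0 : ℝ) 1, r ≤ t →
      r ^ (d - 1) * Real.exp (2 * s * oscDrift r) ≤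
        Real.exp (2 * K) * (t ^ (d - 1) * Real.exp (2 * s * oscDrift t)) := by
    intro r hr t ht hrt
    have h1 := (abs_le.1 (hK r hr)).2
    have h2 := (abs_le.1 (hK t ht)).1
    calc r ^ (d - 1) * Real.exp (2 * s * oscDrift r)
        ≤ t ^ (d - 1) * Real.exp (2 * K + 2 * s * oscDrift t) := by
          refine mul_le_mul (pow_le_pow_left₀ hr.1 hrt _) (Real.exp_le_exp.2 (by linarith))
            (Real.exp_pos _).le (pow_nonneg ht.1 _)
      _ = _ := by
          rw [Real.exp_add]
          ring
  obtain ⟨μ, φ, hφ, -⟩ := exists_neumann_eigenfunction (c := c)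
    zero_lt_one le_rfl hcont hpos (Real.exp_pos _).le hM hc
    (continuous_const.mul continuous_deriv_oscDrift).continuousOn hw
  refine ⟨μ, fun ν => ⟨fun hν => ?_, fun h => h ▸ ⟨φ, hφ⟩⟩⟩
  have hpos' : ∀ r ∈ Ioo (0 : ℝ) 1, 0 < r ^ (d - 1) * Real.exp (2 * s * oscDrift r) :=
    fun r hr => hpos r (Ioo_subset_Ioc_self hr)
  exact le_antisymm (hν.le_of_neumann zero_lt_one hcont hpos' hw ⟨φ, hφ⟩)
    (IsPrincipalEigenvalue.le_of_neumann zero_lt_one hcont hpos' hw ⟨φ, hφ⟩ hν)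

theorem exists_middleEigenvalue (hd : 1 ≤ d) (hc : Continuous c) :
    ∃ (lam : ℝ) (ψ : ℝ → ℝ),
      IsPositiveEigenfunction d (fun _ => 0) c (1 / 3) (2 / 3) .neumann .neumann lam ψ ∧
      (∀ r ∈ Icc (1 / 3 : ℝ) (2 / 3), 0 < ψ r) ∧
      ∀ μ, IsMiddleEigenvalue d c .neumann .neumann μ ↔ μ = lam := by
  have h0 : ∀ r ∈ Icc (1 / 3 : ℝ) (2 / 3), 0 < r := fun r hr => by linarith [hr.1]
  have hcont : Continuous fun r : ℝ => r ^ (d - 1) := by fun_prop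
  have hw : ∀ r ∈ Ioo (1 / 3 : ℝ) (2 / 3), _ := fun r hr =>
    hasDerivAt_middleWeight hd (h0 r (Ioo_subset_Icc_self hr))
  have hlt : (1 / 3 : ℝ) < 2 / 3 := by norm_num
  obtain ⟨μ, φ, hφ, hφpos⟩ := exists_neumann_eigenfunction (v := fun _ => 0) (c := c) (M := 1)
    hlt (by norm_num) hcont (fun r hr => pow_pos (h0 r (Ioc_subset_Icc_self hr)) _) zero_le_one
    (fun r hr t ht hrt => by rw [one_mul]; exact pow_le_pow_left₀ (h0 r hr).le hrt _) hc
    continuousOn_const hw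
  refine ⟨μ, φ, hφ, hφpos, fun ν => ⟨fun hν => ?_, fun h => h ▸ ⟨φ, hφ⟩⟩⟩
  have hpos' : ∀ r ∈ Ioo (1 / 3 : ℝ) (2 / 3), 0 < r ^ (d - 1) :=
    fun r hr => pow_pos (h0 r (Ioo_subset_Icc_self hr)) _
  exact le_antisymm (hν.le_of_neumann hlt hcont hpos' hw ⟨φ, hφ⟩)
    (IsPrincipalEigenvalue.le_of_neumann hlt hcont hpos' hw ⟨φ, hφ⟩ hν)

/-- A ball eigenfunction splits into solutions on the two outer intervals (the right one
reflected) and a solution without drift in the middle. -/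
theorem IsBallEigenvalue.exists_flux (hd : 1 ≤ d) {s μ : ℝ}
    (h : IsBallEigenvalue d c oscDrift s μ) :
    ∃ φ φ₁ : ℝ → ℝ, (∀ r ∈ Ioo (0 : ℝ) 1, 0 < φ r) ∧ φ₁ 0 = 0 ∧ φ₁ 1 = 0 ∧
      IsFluxSolution (fun r => r ^ (d - 1)) (fun r => (c r - μ) * φ r) (1 / 3) (2 / 3) φ φ₁ ∧
      IsFluxSolution (fun r => r ^ (d - 1) * Real.exp (2 * s * oscDrift r))
        (fun r => (c r - μ) * φ r) 0 (1 / 3) φ φ₁ ∧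
      IsFluxSolution (fun r => (1 - r) ^ (d - 1) * Real.exp (2 * s * oscDrift r))
        (fun r => (c (1 - r) - μ) * φ (1 - r)) 0 (1 / 3) (fun r => φ (1 - r))
        (fun r => -φ₁ (1 - r)) := by
  obtain ⟨φ, hφ⟩ := h
  have H := hφ.isFluxSolution zero_lt_one fun r hr => hasDerivAt_ballWeight hd s hr.1
  refine ⟨φ, derivWithin φ (Icc 0 1), hφ.pos, hφ.left, hφ.right, ?_,
    H.mono le_rfl (by norm_num), ?_⟩
  · refine (H.mono (by norm_num : (0 : ℝ) ≤ 1 / 3) (by norm_num : (2 / 3 : ℝ) ≤ 1)).congr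
      (fun r hr => ?_) fun r hr => rfl
    rw [oscDrift_eq_zero (Ioo_subset_Icc_self hr)]
    simp
  · have h1 := (H.mono (by norm_num : (0 : ℝ) ≤ 2 / 3) le_rfl).reflect
    -- By symmetry of the drift, reflection changes only the power in the weight, so the left-hand
    -- barriers also serve on the right.
    simp only [oscDrift_one_sub] at h1
    norm_num at h1 ⊢
    exact h1

end Radial

/-! ### The ball eigenvalue at positive and negative peaks -/

section Comparison

variable {d : ℕ} {c : ℝ → ℝ} {lamDD lamNN : ℝ}

theorem middle_mem_Ioo {r : ℝ} (hr : r ∈ Icc (1 / 3 : ℝ) (2 / 3)) : r ∈ Ioo (0 : ℝ) 1 :=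
  ⟨by linarith [hr.1], by linarith [hr.2]⟩

theorem middleWeight_pos {r : ℝ} (hr : r ∈ Icc (1 / 3 : ℝ) (2 / 3)) : 0 < r ^ (d - 1) :=
  pow_pos (middle_mem_Ioo hr).1 _

theorem continuousOn_middleWeight :
    ContinuousOn (fun r : ℝ => r ^ (d - 1)) (Icc (1 / 3) (2 / 3)) := by fun_prop

theorem IsPositiveEigenfunction.middle_flux (hd : 1 ≤ d) {A B : BoundaryType} {μ : ℝ} {ψ : ℝ → ℝ}
    (hψ : IsPositiveEigenfunction d (fun _ => 0) c (1 / 3) (2 / 3) A B μ ψ) :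
    IsFluxSolution (fun r => r ^ (d - 1)) (fun r => (c r - μ) * ψ r) (1 / 3) (2 / 3) ψ
      (derivWithin ψ (Icc (1 / 3) (2 / 3))) :=
  hψ.isFluxSolution (by norm_num) fun _ hr =>
    hasDerivAt_middleWeight hd (middle_mem_Ioo (Ioo_subset_Icc_self hr)).1

theorem third_lt : (1 / 3 : ℝ) < 2 / 3 := by norm_num

theorem third_mem : (1 / 3 : ℝ) ∈ Icc (1 / 3 : ℝ) (2 / 3) := left_mem_Icc.2 third_lt.le

theorem two_thirds_mem : (2 / 3 : ℝ) ∈ Icc (1 / 3 : ℝ) (2 / 3) := right_mem_Icc.2 third_lt.le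

/-- A Dirichlet eigenfunction on the middle interval has non-vanishing derivatives at the
endpoints. -/
theorem IsPositiveEigenfunction.middle_deriv (hd : 1 ≤ d) (hc : Continuous c) {μ : ℝ} {ψ : ℝ → ℝ}
    (hψ : IsPositiveEigenfunction d (fun _ => 0) c (1 / 3) (2 / 3) .dirichlet .dirichlet μ ψ) :
    0 < derivWithin ψ (Icc (1 / 3) (2 / 3)) (1 / 3) ∧
      derivWithin ψ (Icc (1 / 3) (2 / 3)) (2 / 3) < 0 := by
  obtain ⟨K, hK⟩ := isCompact_Icc.exists_bound_of_continuousOn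
    ((hc.sub continuous_const).continuousOn (s := Icc (1 / 3 : ℝ) (2 / 3))
      (f := fun r => c r - μ))
  exact ⟨(hψ.middle_flux hd).deriv_left_pos continuousOn_middleWeight third_lt
      (fun r hr => middleWeight_pos hr) hK hψ.pos hψ.left,
    (hψ.middle_flux hd).deriv_right_neg continuousOn_middleWeight third_lt
      (fun r hr => middleWeight_pos hr) hK hψ.pos hψ.right⟩

/-- The parameter `μ` of a solution that is positive on the closed middle interval is less than
`λ^{DD}`. -/
theorem lt_dirichlet (hd : 1 ≤ d) (hc : Continuous c)
    (hDD : IsMiddleEigenvalue d c .dirichlet .dirichlet lamDD) {μ : ℝ} {φ φ₁ : ℝ → ℝ}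
    (H : IsFluxSolution (fun r => r ^ (d - 1)) (fun r => (c r - μ) * φ r) (1 / 3) (2 / 3) φ φ₁)
    (hφ : ∀ r ∈ Icc (1 / 3 : ℝ) (2 / 3), 0 < φ r) : μ < lamDD := by
  obtain ⟨ψ, hψ⟩ := hDD
  obtain ⟨h1, h2⟩ := hψ.middle_deriv hd hc
  have hψa : ψ (1 / 3) = 0 := hψ.left
  have hψb : ψ (2 / 3) = 0 := hψ.right
  have Hψ := hψ.middle_flux hd
  by_contra! hle
  -- If `μ ≥ λ^{DD}` the Wronskian is nonincreasing, yet the nonzero boundary slopes of `ψ` make it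
  -- negative at `1/3` and positive at `2/3`.
  have hanti : AntitoneOn (fun r => r ^ (d - 1) * φ₁ r * ψ r -
      φ r * (r ^ (d - 1) * derivWithin ψ (Icc (1 / 3) (2 / 3)) r)) (Icc (1 / 3) (2 / 3)) := by
    refine antitoneOn_of_deriv_nonpos (convex_Icc _ _) ?_ ?_ ?_
    · exact ((continuousOn_middleWeight.mul H.continuousOn_deriv).mul Hψ.continuousOn).sub
        (H.continuousOn.mul (continuousOn_middleWeight.mul Hψ.continuousOn_deriv))
    · intro r hr
      rw [interior_Icc] at hr
      exact (((H.hasDerivAt_flux r hr).mul (Hψ.hasDerivAt r hr)).sub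
        ((H.hasDerivAt r hr).mul
          (Hψ.hasDerivAt_flux r hr))).differentiableAt.differentiableWithinAt
    · intro r hr
      rw [interior_Icc] at hr
      have hd' := ((H.hasDerivAt_flux r hr).mul (Hψ.hasDerivAt r hr)).sub
        ((H.hasDerivAt r hr).mul (Hψ.hasDerivAt_flux r hr))
      have e := hd'.deriv
      refine (le_of_eq e).trans ?_
      have hr' := Ioo_subset_Icc_self hr
      have := mul_nonneg (mul_nonneg (middleWeight_pos (d := d) hr').le (sub_nonneg.2 hle))
        (mul_pos (hφ r hr') (hψ.pos r hr)).le
      linarith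
  have h3 := hanti third_mem two_thirds_mem third_lt.le
  simp only [hψa, hψb, mul_zero, zero_sub] at h3
  have h4 := mul_pos (hφ _ third_mem) (mul_pos (middleWeight_pos (d := d) third_mem) h1)
  have h5 := mul_pos (hφ _ two_thirds_mem)
    (mul_pos (middleWeight_pos (d := d) two_thirds_mem) (neg_pos.2 h2))
  linarith

/-- Bounds for the weights on the two outer intervals near the middle one. -/
theorem outerWeight_bounds {r t : ℝ} (ht : t = r ∨ t = 1 - r)
    (hr : r ∈ Icc (1 / 6 : ℝ) (1 / 3)) :
    (1 / 6 : ℝ) ^ (d - 1) ≤ t ^ (d - 1) ∧ t ^ (d - 1) ≤ 1 := by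
  have h : 1 / 6 ≤ t ∧ t ≤ 1 := by
    rcases ht with rfl | rfl <;> constructor <;> linarith [hr.1, hr.2]
  exact ⟨pow_le_pow_left₀ (by norm_num) h.1 _, pow_le_one₀ (by linarith) h.2⟩

theorem exists_outer_gap (hc : Continuous c)
    (H1 : ∀ r ∈ Icc (0 : ℝ) (1 / 3) ∪ Icc (2 / 3) 1, lamDD < c r) :
    ∃ κ > 0, ∀ r ∈ Icc (0 : ℝ) (1 / 3), κ ≤ c r - lamDD ∧ κ ≤ c (1 - r) - lamDD := by
  have hcomp : IsCompact (Icc (0 : ℝ) (1 / 3) ∪ Icc (2 / 3) 1) :=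
    isCompact_Icc.union isCompact_Icc
  obtain ⟨y, hy, hmin⟩ := hcomp.exists_isMinOn ⟨0, .inl ⟨le_rfl, by norm_num⟩⟩ hc.continuousOn
  refine ⟨c y - lamDD, sub_pos.2 (H1 y hy), fun r hr => ⟨?_, ?_⟩⟩
  · have : c y ≤ c r := hmin (.inl hr)
    linarith
  · have : c y ≤ c (1 - r) := hmin (.inr ⟨by linarith [hr.2], by linarith [hr.1]⟩)
    linarith

theorem ballEigenvalue_near_dirichlet (hd : 1 ≤ d) (hc : Continuous c)
    (hDD : IsMiddleEigenvalue d c .dirichlet .dirichlet lamDD)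
    (H1 : ∀ r ∈ Icc (0 : ℝ) (1 / 3) ∪ Icc (2 / 3) 1, lamDD < c r) {ε : ℝ} (hε : 0 < ε) :
    ∃ δ > 0, ∀ x, 0 < x → x < δ →
      ((∀ r ∈ Icc (1 / 3 - x) (1 / 3 - x / 2), x ^ 2 / 8 ≤ oscDrift r) ∧
        (∀ r ∈ Icc (1 / 3 - x) (1 / 3), -x ^ 4 ≤ oscDrift r)) →
      ∀ μ, IsBallEigenvalue d c oscDrift (1 / x ^ 4) μ → |μ - lamDD| ≤ ε := by
  obtain ⟨κ, hκ, hgap⟩ := exists_outer_gap hc H1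
  obtain ⟨ψ, hψ⟩ := id hDD
  obtain ⟨η, hη, hlow⟩ := IsFluxSolution.exists_lower_bound third_lt continuousOn_middleWeight
    (fun r hr => middleWeight_pos (Ioo_subset_Icc_self hr)) (middleWeight_pos third_mem).le
    (middleWeight_pos two_thirds_mem).le hc (hψ.middle_flux hd) hψ.pos hψ.left hψ.right
    (H1 _ (.inl ⟨by norm_num, le_rfl⟩)) (H1 _ (.inr ⟨le_rfl, by norm_num⟩)) hε
  set w₀ : ℝ := (1 / 6 : ℝ) ^ (d - 1) with hw₀
  have hw₀pos : 0 < w₀ := by positivity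
  set C := Real.exp 2 / w₀ + 8 / (w₀ * κ) with hC
  have hC0 : 0 < C := by positivity
  -- The bound `1 / 6` keeps the layer where the power weight lies between `w₀` and `1`; the other
  -- gives `C * x ≤ η`.
  refine ⟨min (1 / 6) (η / C), by positivity, fun x hx hxδ hpeak μ hμ => ?_⟩
  obtain ⟨φ, φ₁, hφ, h0, h1, Hm, Hl, Hr⟩ := hμ.exists_flux hd
  have hφm : ∀ r ∈ Icc (1 / 3 : ℝ) (2 / 3), 0 < φ r := fun r hr => hφ r (middle_mem_Ioo hr)
  have hlt := lt_dirichlet hd hc hDD Hm hφm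
  have hx6 : x < 1 / 6 := hxδ.trans_le (min_le_left _ _)
  have hCx : C * x ≤ η := by
    have := (lt_div_iff₀ hC0).1 (hxδ.trans_le (min_le_right _ _))
    linarith
  have hs : 1 / x ^ 4 * x ^ 4 = 1 := by field_simp
  have hm0 := oscDrift_eq_zero third_mem
  have hl := Hl.le_deriv_of_positive_peak (by fun_prop) continuous_oscDrift
    (fun r hr => pow_pos hr.1 _) hw₀pos (fun r hr => outerWeight_bounds (.inl rfl) hr) hκ
    (fun r hr => by linarith [(hgap r (Ioo_subset_Icc_self hr)).1])
    (fun r hr => hφ r ⟨hr.1, by linarith [hr.2]⟩) h0 hx hx6 hs hm0 hpeak.1 hpeak.2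
  have hr := Hr.le_deriv_of_positive_peak (by fun_prop) continuous_oscDrift
    (fun r hr => pow_pos (by linarith [hr.2]) _) hw₀pos
    (fun r hr => outerWeight_bounds (.inr rfl) hr) hκ
    (fun r hr => by linarith [(hgap r (Ioo_subset_Icc_self hr)).2])
    (fun r hr => hφ _ ⟨by linarith [hr.2], by linarith [hr.1]⟩) (by simpa using h1)
    hx hx6 hs hm0 hpeak.1 hpeak.2
  have e23 : (1 : ℝ) - 1 / 3 = 2 / 3 := by norm_num
  simp only [e23] at hr
  have hCx0 : 0 < C * x := by positivity
  have hφ13 := hφm _ third_mem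
  have hφ23 := hφm _ two_thirds_mem
  have hd1 : 0 < φ₁ (1 / 3) := pos_of_mul_pos_left (hφ13.trans_le hl) hCx0.le
  have hd2 : 0 < -φ₁ (2 / 3) := pos_of_mul_pos_left (hφ23.trans_le hr) hCx0.le
  have hge := hlow μ φ φ₁ Hm hφm
    (hl.trans (by rw [mul_comm]; exact mul_le_mul_of_nonneg_right hCx hd1.le))
    (hr.trans (by rw [mul_comm]; exact mul_le_mul_of_nonneg_right hCx hd2.le))
  rw [abs_le]
  constructor <;> linarith

theorem ballEigenvalue_near_neumann (hd : 1 ≤ d) (hc : Continuous c)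
    (hDD : IsMiddleEigenvalue d c .dirichlet .dirichlet lamDD)
    (H1 : ∀ r ∈ Icc (0 : ℝ) (1 / 3) ∪ Icc (2 / 3) 1, lamDD < c r) {ψ : ℝ → ℝ}
    (hψ : IsPositiveEigenfunction d (fun _ => 0) c (1 / 3) (2 / 3) .neumann .neumann lamNN ψ)
    (hψpos : ∀ r ∈ Icc (1 / 3 : ℝ) (2 / 3), 0 < ψ r) {ε : ℝ} (hε : 0 < ε) :
    ∃ δ > 0, ∀ x, 0 < x → x < δ →
      ((∀ r ∈ Icc (1 / 3 - x) (1 / 3 - x / 2), oscDrift r ≤ -(x ^ 2 / 8)) ∧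
        (∀ r ∈ Icc (1 / 3 - x) (1 / 3), oscDrift r ≤ x ^ 4)) →
      ∀ μ, IsBallEigenvalue d c oscDrift (1 / x ^ 4) μ → |μ - lamNN| ≤ ε := by
  obtain ⟨κ, hκ, hgap⟩ := exists_outer_gap hc H1
  obtain ⟨K, hK⟩ := isCompact_Icc.exists_bound_of_continuousOn
    (hc.continuousOn (s := Icc (0 : ℝ) 1))
  have hψa : derivWithin ψ (Icc (1 / 3) (2 / 3)) (1 / 3) = 0 := hψ.left
  have hψb : derivWithin ψ (Icc (1 / 3) (2 / 3)) (2 / 3) = 0 := hψ.right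
  have Hψ := hψ.middle_flux hd
  have hd0 : (0 : ℝ) ≤ d - 1 := by
    have : (1 : ℝ) ≤ d := by exact_mod_cast hd
    linarith
  obtain ⟨η, hη, hup⟩ := Hψ.exists_upper_bound (Λ := lamDD) (R := 3 * ((d : ℝ) - 1))
    third_lt continuousOn_middleWeight (fun r hr => middleWeight_pos hr)
    (fun r hr => hasDerivAt_middleWeight hd (middle_mem_Ioo (Ioo_subset_Icc_self hr)).1)
    (fun r hr => by
      have hr0 := (middle_mem_Ioo (Ioo_subset_Icc_self hr)).1
      rw [add_zero, abs_of_nonneg (div_nonneg hd0 hr0.le), div_le_iff₀ hr0]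
      nlinarith [hr.1]) hc hψpos hψa hψb hε
  set w₀ : ℝ := (1 / 6 : ℝ) ^ (d - 1) with hw₀
  have hw₀pos : 0 < w₀ := by positivity
  set B := |K| + |lamNN| with hB
  set C := 8 + Real.exp 2 * B with hC
  have hC0 : 0 < C := by positivity
  refine ⟨min (1 / 6) (w₀ * η / C), by positivity, fun x hx hxδ hpeak μ hμ => ?_⟩
  obtain ⟨φ, φ₁, hφ, h0, h1, Hm, Hl, Hr⟩ := hμ.exists_flux hd
  have hφm : ∀ r ∈ Icc (1 / 3 : ℝ) (2 / 3), 0 < φ r := fun r hr => hφ r (middle_mem_Ioo hr)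
  have hlt := lt_dirichlet hd hc hDD Hm hφm
  have hx6 : x < 1 / 6 := hxδ.trans_le (min_le_left _ _)
  have hCx : C * x ≤ w₀ * η := by
    have := (lt_div_iff₀ hC0).1 (hxδ.trans_le (min_le_right _ _))
    linarith
  have hs : 1 / x ^ 4 * x ^ 4 = 1 := by field_simp
  have hm0 := oscDrift_eq_zero third_mem
  have e23 : (1 : ℝ) - 1 / 3 = 2 / 3 := by norm_num
  have hφl : ∀ r ∈ Ioc (0 : ℝ) (1 / 3), 0 < φ r := fun r hr => hφ r ⟨hr.1, by linarith [hr.2]⟩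
  have hφr : ∀ r ∈ Ioc (0 : ℝ) (1 / 3), 0 < φ (1 - r) := fun r hr =>
    hφ _ ⟨by linarith [hr.2], by linarith [hr.1]⟩
  have hkl : ∀ r ∈ Ioo (0 : ℝ) (1 / 3), 0 < c r - μ := fun r hr => by
    linarith [(hgap r (Ioo_subset_Icc_self hr)).1]
  have hkr : ∀ r ∈ Ioo (0 : ℝ) (1 / 3), 0 < c (1 - r) - μ := fun r hr => by
    linarith [(hgap r (Ioo_subset_Icc_self hr)).2]
  have hd1 : 0 < φ₁ (1 / 3) := Hl.flux_pos (continuous_ballWeight _).continuousOn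
    (fun r hr => mul_pos (pow_pos hr.1 _) (Real.exp_pos _))
    (fun r hr => mul_pos (hkl r hr) (hφl r (Ioo_subset_Ioc_self hr))) h0 _
    ⟨by norm_num, le_rfl⟩
  have hd2 : 0 < -φ₁ (2 / 3) := by
    have hcont : Continuous fun r : ℝ =>
        (1 - r) ^ (d - 1) * Real.exp (2 * (1 / x ^ 4) * oscDrift r) := by
      have := continuous_oscDrift
      fun_prop
    have := Hr.flux_pos hcont.continuousOn
      (fun r hr => mul_pos (pow_pos (by linarith [hr.2]) _) (Real.exp_pos _))
      (fun r hr => mul_pos (hkr r hr) (hφr r (Ioo_subset_Ioc_self hr))) (by simpa using h1)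
      (1 / 3) ⟨by norm_num, le_rfl⟩
    simpa only [e23] using this
  -- The flux of `φ` enters the middle from both sides, so the Wronskian with `ψ` is positive at
  -- `1/3` and negative at `2/3`; it would increase if `μ < λ^{NN}`. The bound also makes `B` an
  -- upper bound for `c - μ`.
  have hNN : lamNN ≤ μ := by
    by_contra! hlt'
    have hW := Hm.wronskian_lt Hψ continuousOn_middleWeight third_lt fun r hr => by
      have hr' := Ioo_subset_Icc_self hr
      have := mul_pos (mul_pos (middleWeight_pos (d := d) hr') (sub_pos.2 hlt'))
        (mul_pos (hφm r hr') (hψ.pos r hr))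
      linarith
    rw [hψa, hψb] at hW
    have f1 := mul_pos (middleWeight_pos (d := d) third_mem) (mul_pos hd1 (hψpos _ third_mem))
    have f2 := mul_pos (middleWeight_pos (d := d) two_thirds_mem)
      (mul_pos hd2 (hψpos _ two_thirds_mem))
    linarith
  have hcB : ∀ r ∈ Icc (0 : ℝ) 1, c r - μ ≤ B := fun r hr => by
    have := (abs_le.1 (hK r hr)).2
    linarith [le_abs_self K, neg_abs_le lamNN]
  have hl := Hl.deriv_le_of_negative_peak (by fun_prop) continuous_oscDrift
    (fun r hr => pow_pos hr.1 _) (fun r hr => outerWeight_bounds (.inl rfl) hr) hkl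
    (fun r hr => hcB r ⟨hr.1.le, by linarith [hr.2]⟩) hφl h0 hx hx6 hs hm0 hpeak.1 hpeak.2
  have hr := Hr.deriv_le_of_negative_peak (by fun_prop) continuous_oscDrift
    (fun r hr => pow_pos (by linarith [hr.2]) _) (fun r hr => outerWeight_bounds (.inr rfl) hr)
    hkr (fun r hr => hcB _ ⟨by linarith [hr.2], by linarith [hr.1]⟩) hφr (by simpa using h1)
    hx hx6 hs hm0 hpeak.1 hpeak.2
  simp only [e23] at hr
  have hφ13 := hφm _ third_mem
  have hφ23 := hφm _ two_thirds_mem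
  have hle := hup μ φ φ₁ hlt.le Hm hφm
    (le_of_mul_le_mul_left (hl.trans ((mul_le_mul_of_nonneg_left hCx hφ13.le).trans_eq
      (by ring : _ = w₀ * (η * φ (1 / 3))))) hw₀pos)
    (le_of_mul_le_mul_left (hr.trans ((mul_le_mul_of_nonneg_left hCx hφ23.le).trans_eq
      (by ring : _ = w₀ * (η * φ (2 / 3))))) hw₀pos)
  rw [abs_le]
  constructor <;> linarith

end Comparison

theorem theorem1p1 (d : ℕ) (hd : 1 ≤ d) (c : ℝ → ℝ) (hc : ContinuousOn c (Icc 0 1))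
    (lamDD : ℝ) (hDD : IsMiddleEigenvalue d c .dirichlet .dirichlet lamDD)
    (H1 : ∀ r ∈ Icc (0 : ℝ) (1 / 3) ∪ Icc (2 / 3) 1, lamDD < c r) :
    ∃ lamNN : ℝ, (∀ μ : ℝ, IsMiddleEigenvalue d c .neumann .neumann μ ↔ μ = lamNN) ∧
    ∃ m : ℝ → ℝ,
      ContDiffOn ℝ 1 m (Icc 0 1) ∧
      (∀ r ∈ Icc (1 / 3 : ℝ) (2 / 3), m r = 0) ∧
      (∀ r ∈ Icc (0 : ℝ) 1, m r = m (1 - r)) ∧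
      OscillatesInfinitely m (𝓝[<] (1 / 3)) ∧
      OscillatesInfinitely m (𝓝[>] (2 / 3)) ∧
      ∃ lam : ℝ → ℝ,
        (∀ s μ : ℝ, IsBallEigenvalue d c m s μ ↔ μ = lam s) ∧
        (¬ ∃ L : ℝ, Tendsto lam atTop (𝓝 L)) ∧
        (∃ s : ℕ → ℝ, Tendsto s atTop atTop ∧
          Tendsto (fun n => lam (s n)) atTop (𝓝 lamDD)) ∧
        (∃ s : ℕ → ℝ, Tendsto s atTop atTop ∧
          Tendsto (fun n => lam (s n)) atTop (𝓝 lamNN)) := by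
  -- The lemmas use a potential continuous on the line; eigenvalues see only its values in the
  -- interval.
  obtain ⟨C, hC, hCc⟩ : ∃ C : ℝ → ℝ, Continuous C ∧ ∀ r ∈ Icc (0 : ℝ) 1, C r = c r :=
    ⟨IccExtend zero_le_one ((Icc (0 : ℝ) 1).domRestrict c),
      (continuousOn_iff_continuous_domRestrict.1 hc).Icc_extend',
      fun r hr => IccExtend_of_mem _ _ hr⟩
  have hmid : ∀ r ∈ Ioo (1 / 3 : ℝ) (2 / 3), C r = c r := fun r hr =>
    hCc r (Ioo_subset_Icc_self (middle_mem_Ioo (Ioo_subset_Icc_self hr)))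
  have hDD' : IsMiddleEigenvalue d C .dirichlet .dirichlet lamDD :=
    (isPrincipalEigenvalue_congr hmid).2 hDD
  have H1' : ∀ r ∈ Icc (0 : ℝ) (1 / 3) ∪ Icc (2 / 3) 1, lamDD < C r := fun r hr => by
    rw [hCc r]
    · exact H1 r hr
    · rcases hr with hr | hr <;> constructor <;> linarith [hr.1, hr.2]
  obtain ⟨lamNN, ψ, hψ, hψpos, hNN⟩ := exists_middleEigenvalue hd hC
  choose lam hlam using exists_ballEigenvalue hd hC
  have hlt : lamNN < lamDD := lt_dirichlet hd hC hDD' (hψ.middle_flux hd) hψpos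
  obtain ⟨s, hs, hsl⟩ : ∃ s : ℕ → ℝ, Tendsto s atTop atTop ∧
      Tendsto (fun n => lam (s n)) atTop (𝓝 lamDD) := by
    refine exists_seq_tendsto_of_scales (fun ε hε => exists_oscDrift_positive_peak hε)
      fun ε hε => ?_
    obtain ⟨δ, hδ, h⟩ := ballEigenvalue_near_dirichlet hd hC hDD' H1' hε
    exact ⟨δ, hδ, fun x hx hxδ hP => h x hx hxδ hP _ ((hlam _ _).2 rfl)⟩
  obtain ⟨t, ht, htl⟩ : ∃ s : ℕ → ℝ, Tendsto s atTop atTop ∧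
      Tendsto (fun n => lam (s n)) atTop (𝓝 lamNN) := by
    refine exists_seq_tendsto_of_scales (fun ε hε => exists_oscDrift_negative_peak hε)
      fun ε hε => ?_
    obtain ⟨δ, hδ, h⟩ := ballEigenvalue_near_neumann hd hC hDD' H1' hψ hψpos hε
    exact ⟨δ, hδ, fun x hx hxδ hP => h x hx hxδ hP _ ((hlam _ _).2 rfl)⟩
  refine ⟨lamNN, fun μ => (isPrincipalEigenvalue_congr hmid).symm.trans (hNN μ), oscDrift,
    contDiff_oscDrift.contDiffOn, fun r hr => oscDrift_eq_zero hr,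
    fun r _ => (oscDrift_one_sub r).symm, oscillatesInfinitely_left, oscillatesInfinitely_right,
    lam, fun σ μ => (isPrincipalEigenvalue_congr
      fun r hr => hCc r (Ioo_subset_Icc_self hr)).symm.trans (hlam σ μ),
    ?_, ⟨s, hs, hsl⟩, ⟨t, ht, htl⟩⟩
  -- A limit would equal both subsequential limits, contradicting `λ^{NN} < λ^{DD}`.
  rintro ⟨L, hL⟩
  exact hlt.ne ((tendsto_nhds_unique htl (hL.comp ht)).trans
    (tendsto_nhds_unique (hL.comp hs) hsl))
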